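/- Let $N\ge 1$ and let $\langle\,\cdot\,\rangle$ be the average over the eigenvalues $\zeta_j=e^{i\theta_j}$, $0\le\theta_j<2\pi$, of the circular orthogonal ensemble (COE), i.e. with respect to the probability density on $[0,2\pi)^N$ proportional to $\prod_{1\le j<k\le N}|\zeta_j-\zeta_k|$. For $z\in\mathbb{C}$ with $|z|\ne 1$ put $A(z)=\sum_{j=1}^N\frac{\zeta_j+z}{\zeta_j-z}$, and define the second resolvent function (connected two-point function) $$W_2(z_1,z_2)=\langle A(z_1)A(z_2)\rangle-\langle A(z_1)\rangle\langle A(z_2)\rangle .$$ (a) For all complex $z_1,z_2$ with $|z_1|<1<|z_2|$ (the $(0,\infty)$ domain), with $\zeta=z_1/z_2$, $$\begin{aligned} W_2(z_1,z_2)={}&\frac{4\zeta^N}{1-\zeta}+\frac{4}{(1-\zeta)^2}\left[-2\zeta(1-\zeta^N)+\zeta-\zeta^N\right]\\ &+\frac{4}{N+1}\left[\frac{2\zeta^2(1-\zeta^N)}{(1-\zeta)^2}-\frac{\zeta}{1-\zeta}\bigl(N-1+(N+1)\zeta^N\bigr)\right]{}_2F_1\!\left(1,\tfrac{N+1}{2};\tfrac{N+3}{2};\zeta\right).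 \end{aligned}$$ (b) (Global large-$N$ expansion.) For every $0<\delta<1$ there is a constant $C$, depending only on $\delta$, such that for all $N\ge1$ and all complex $z_1,z_2$ with $|z_1|<1-\delta$ and $|z_2|>1+\delta$, with $\zeta=z_1/z_2$, $$\left|W_2(z_1,z_2)+8\sum_{j=0}^{9}\frac{\zeta\,P_j(\zeta)}{N^{j}(\zeta-1)^{j+2}}\right|\le \frac{C}{N^{10}},$$ where $$\begin{aligned} P_0={}&1,\qquad P_1=1+\zeta,\qquad P_2=1+4\zeta+\zeta^2,\qquad P_3=1+15\zeta+15\zeta^2+\zeta^3,\\ P_4={}&1+50\zeta+138\zeta^2+50\zeta^3+\zeta^4,\\ P_5={}&1+157\zeta+994\zeta^2+994\zeta^3+157\zeta^4+\zeta^5,\\ P_6={}&1+480\zeta+6231\zeta^2+13456\zeta^3+6231\zeta^4+480\zeta^5+\zeta^6,\\ P_7={}&1+1451\zeta+35961\zeta^2+146907\zeta^3+146907\zeta^4+35961\zeta^5+1451\zeta^6+\zeta^7,\\ P_8={}&1+4366\zeta+197224\zeta^2+1402834\zeta^3+2597230\zeta^4+1402834\zeta^5+197224\zeta^6+4366\zeta^7+\zeta^8,\\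 P_9={}&1+13113\zeta+1047252\zeta^2+12262436\zeta^3+38286798\zeta^4+38286798\zeta^5\\ &+12262436\zeta^6+1047252\zeta^7+13113\zeta^8+\zeta^9 . \end{aligned}$$ -/

import Mathlib

open MeasureTheory

namespace CircularEnsemble

noncomputable section

/-- The point `e^{iθ}` of the unit circle. -/
def unitPoint (θ : ℝ) : ℂ := Complex.exp (Complex.I * (θ : ℂ))

/-- Lebesgue measure `dθ₁ ⋯ dθ_N` on the box `[0, 2π)^N`. -/
def angleMeasure (N : ℕ) : Measure (Fin N → ℝ) :=
  volume.restrict (Set.univ.pi fun _ => Set.Ico 0 (2 * Real.pi))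

/-- The weight `∏_{j < k} |e^{iθ_j} - e^{iθ_k}|^{2κ}` of the Dyson circular ensemble with inverse
temperature `β = 2κ`. -/
def weight (N : ℕ) (κ : ℝ) (θ : Fin N → ℝ) : ℝ :=
  ∏ j : Fin N, ∏ k ∈ Finset.Ioi j, ‖unitPoint (θ j) - unitPoint (θ k)‖ ^ (2 * κ)

/-- The normalisation `Z_N`, with respect to `dθ_j / 2π = dζ_j / (2πi ζ_j)` for each particle. -/
def partitionFunction (N : ℕ) (κ : ℝ) : ℝ :=
  ((2 * Real.pi) ^ N)⁻¹ * ∫ θ, weight N κ θ ∂(angleMeasure N)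

/-- The eigenvalue probability density function, with respect to `∏_j dθ_j / 2π`. -/
def density (N : ℕ) (κ : ℝ) (θ : Fin N → ℝ) : ℝ :=
  (partitionFunction N κ)⁻¹ * weight N κ θ

/-- The ensemble average `⟨f⟩` of a function of the angles. -/
def average (N : ℕ) (κ : ℝ) (f : (Fin N → ℝ) → ℂ) : ℂ :=
  (((2 * Real.pi) ^ N)⁻¹ : ℝ) * ∫ θ, f θ * (density N κ θ : ℂ) ∂(angleMeasure N)

/-- The linear statistic `∑_j (ζ_j + z) / (ζ_j - z)`, where `ζ_j = e^{iθ_j}`. -/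
def herglotzSum (N : ℕ) (z : ℂ) (θ : Fin N → ℝ) : ℂ :=
  ∑ j : Fin N, (unitPoint (θ j) + z) / (unitPoint (θ j) - z)

/-- The first resolvent function. -/
def W₁ (N : ℕ) (κ : ℝ) (z : ℂ) : ℂ := average N κ (herglotzSum N z)

/-- The second unconnected resolvent function (mixed second moment). -/
def U₂ (N : ℕ) (κ : ℝ) (z₁ z₂ : ℂ) : ℂ :=
  average N κ fun θ => herglotzSum N z₁ θ * herglotzSum N z₂ θ

/-- The second resolvent function, that is the mixed second cumulant of the two linear statistics
(without complex conjugation). -/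
def W₂ (N : ℕ) (κ : ℝ) (z₁ z₂ : ℂ) : ℂ := U₂ N κ z₁ z₂ - W₁ N κ z₁ * W₁ N κ z₂

/-- The second resolvent function of the circular orthogonal ensemble, `β = 2κ = 1`. -/
def coeW₂ (N : ℕ) (z₁ z₂ : ℂ) : ℂ := W₂ N (1 / 2) z₁ z₂

/-- The closed form for the second resolvent function of the circular orthogonal ensemble. -/
def coeExact (N : ℕ) (ζ : ℂ) : ℂ :=
  4 * (1 - ζ)⁻¹ * ζ ^ N
    + 4 * ((1 - ζ) ^ 2)⁻¹ * (-2 * ζ * (1 - ζ ^ N) + ζ - ζ ^ N)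
    + 4 / ((N : ℂ) + 1)
      * (2 * ζ ^ 2 * ((1 - ζ) ^ 2)⁻¹ * (1 - ζ ^ N)
          - ζ * (1 - ζ)⁻¹ * ((N : ℂ) - 1 + ((N : ℂ) + 1) * ζ ^ N))
      * ordinaryHypergeometric (1 : ℂ) (((N : ℂ) + 1) / 2) (((N : ℂ) + 3) / 2) ζ

/-- The global large `N` expansion of the second resolvent function of the circular orthogonal
ensemble, truncated after the term in `N^{-9}`. -/
def coeGlobalExpansion (N : ℕ) (ζ : ℂ) : ℂ :=
  -8 * ζ / (ζ - 1) ^ 2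
  - 8 / ((N : ℂ) * (ζ - 1) ^ 3) * ζ * (1 + ζ)
  - 8 / ((N : ℂ) ^ 2 * (ζ - 1) ^ 4) * ζ * (1 + 4 * ζ + ζ ^ 2)
  - 8 / ((N : ℂ) ^ 3 * (ζ - 1) ^ 5) * ζ * (1 + 15 * ζ + 15 * ζ ^ 2 + ζ ^ 3)
  - 8 / ((N : ℂ) ^ 4 * (ζ - 1) ^ 6) * ζ * (1 + 50 * ζ + 138 * ζ ^ 2 + 50 * ζ ^ 3 + ζ ^ 4)
  - 8 / ((N : ℂ) ^ 5 * (ζ - 1) ^ 7) * ζ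
      * (1 + 157 * ζ + 994 * ζ ^ 2 + 994 * ζ ^ 3 + 157 * ζ ^ 4 + ζ ^ 5)
  - 8 / ((N : ℂ) ^ 6 * (ζ - 1) ^ 8) * ζ
      * (1 + 480 * ζ + 6231 * ζ ^ 2 + 13456 * ζ ^ 3 + 6231 * ζ ^ 4 + 480 * ζ ^ 5 + ζ ^ 6)
  - 8 / ((N : ℂ) ^ 7 * (ζ - 1) ^ 9) * ζ
      * (1 + 1451 * ζ + 35961 * ζ ^ 2 + 146907 * ζ ^ 3 + 146907 * ζ ^ 4 + 35961 * ζ ^ 5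
          + 1451 * ζ ^ 6 + ζ ^ 7)
  - 8 / ((N : ℂ) ^ 8 * (ζ - 1) ^ 10) * ζ
      * (1 + 4366 * ζ + 197224 * ζ ^ 2 + 1402834 * ζ ^ 3 + 2597230 * ζ ^ 4 + 1402834 * ζ ^ 5
          + 197224 * ζ ^ 6 + 4366 * ζ ^ 7 + ζ ^ 8)
  - 8 / ((N : ℂ) ^ 9 * (ζ - 1) ^ 11) * ζ
      * (1 + 13113 * ζ + 1047252 * ζ ^ 2 + 12262436 * ζ ^ 3 + 38286798 * ζ ^ 4
          + 38286798 * ζ ^ 5 + 12262436 * ζ ^ 6 + 1047252 * ζ ^ 7 + 13113 * ζ ^ 8 + ζ ^ 9)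

end

end CircularEnsemble

namespace CircularEnsemble

/-! On the box `(0, 2π)^N` each factor `|ζ_j - ζ_k|` is the sign of `θ_k - θ_j` times a
trigonometric polynomial in half angles. The COE weight is therefore `ordSign θ`, the sign of the
real Vandermonde of the angles, times an antisymmetrised exponential with doubled exponents `-(N-1),
…, N-1` (`weight_eq`). Averages of trigonometric monomials thus reduce to the coefficients
`signFourier p`.

These coefficients have a Pfaffian structure. Integrating one variable by parts against the sign
functions concentrates it on the other angles, and integrating the angle it lands on forces the two
exponents to be opposite (`signFourier_expand`). So `signFourier p` is nonzero only if the exponents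
pair off under negation, and a pair `±m` contributes in proportion to `1/m`
(`signFourier_eq_zero_of_no_partner`, `signFourier_replace_pair`).

For `⟨p_k p_{-l}⟩`, with `p_k` the power sums, one exponent is raised by `2k` and one lowered by
`2l`. The average vanishes for `k ≠ l`, and for `k = l ≥ 1` only a few pairs of positions survive
(`sum_signFourier_shiftExp`); this is the COE form factor `average_powerSum_mul_self`. Expanding the
two Herglotz kernels in geometric series turns `W₂` into a power series in `ζ = z₁/z₂`, which sums
to rational functions of `ζ` and `ζ^N` and the single series `∑ ζ^n/(N+1+2n)`. That series is the
hypergeometric function of part (a).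

For part (b), `1/(N+(2n+1))` is expanded in powers of `(2n+1)/N`. The coefficients `∑ (2n+1)^j ζ^n`
are explicit rational functions, the remainder is controlled term by term, and everything multiplied
by `ζ^N` is exponentially small on the given domain. -/

/-! ### Sign functions and integration by parts against them. -/

/-- The sign of a real number, as a complex number. -/
noncomputable def csign : ℝ →*₀ ℂ := (SignType.castHom : SignType →*₀ ℂ).comp signHom

theorem csign_of_pos {x : ℝ} (hx : 0 < x) : csign x = 1 := by
  simp [csign, sign_pos hx]

theorem csign_of_neg {x : ℝ} (hx : x < 0) : csign x = -1 := by
  simp [csign, sign_neg hx]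

theorem csign_neg (x : ℝ) : csign (-x) = -csign x := by
  rcases lt_trichotomy x 0 with h | rfl | h
  · rw [csign_of_neg h, csign_of_pos (neg_pos.2 h), neg_neg]
  · simp
  · rw [csign_of_pos h, csign_of_neg (neg_neg_of_pos h)]

theorem csign_mul_self {x : ℝ} (hx : x ≠ 0) : csign x * csign x = 1 := by
  rcases lt_or_gt_of_ne hx with h | h
  · rw [csign_of_neg h]; norm_num
  · rw [csign_of_pos h]; norm_num

theorem norm_csign_le (x : ℝ) : ‖csign x‖ ≤ 1 := by
  rcases lt_trichotomy x 0 with h | rfl | h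
  · rw [csign_of_neg h]; simp
  · simp
  · rw [csign_of_pos h]; simp

theorem measurable_csign : Measurable (csign : ℝ → ℂ) := by
  have : (csign : ℝ → ℂ) = fun x => if 0 < x then 1 else if x < 0 then -1 else 0 := by
    funext x
    rcases lt_trichotomy x 0 with h | rfl | h
    · rw [csign_of_neg h, if_neg h.not_gt, if_pos h]
    · simp
    · rw [csign_of_pos h, if_pos h]
  rw [this]
  exact Measurable.ite measurableSet_Ioi measurable_const
    (Measurable.ite measurableSet_Iio measurable_const measurable_const)

theorem measurable_prod_csign {ι : Type*} (S : Finset ι) (t : ι → ℝ) :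
    Measurable fun x : ℝ => ∏ k ∈ S, csign (t k - x) :=
  Finset.measurable_prod S fun _ _ => measurable_csign.comp (measurable_const.sub measurable_id)

theorem norm_prod_csign_le {ι : Type*} (S : Finset ι) (f : ι → ℝ) :
    ‖∏ k ∈ S, csign (f k)‖ ≤ 1 := by
  rw [norm_prod]
  exact Finset.prod_le_one (fun _ _ => norm_nonneg _) fun _ _ => norm_csign_le _

theorem intervalIntegrable_mul_prod_csign {ι : Type*} {g : ℝ → ℂ} (hg : Continuous g)
    (S : Finset ι) (t : ι → ℝ) (u v : ℝ) :
    IntervalIntegrable (fun x => g x * ∏ k ∈ S, csign (t k - x)) volume u v := by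
  refine (hg.intervalIntegrable u v (μ := volume)).mono_fun
    (hg.measurable.mul (measurable_prod_csign S t)).aestronglyMeasurable ?_
  filter_upwards with x
  rw [norm_mul]
  exact mul_le_of_le_one_right (norm_nonneg _) (norm_prod_csign_le _ _)

/-- Integration by parts against a product of sign functions. -/
theorem integral_deriv_mul_prod_csign {ι : Type*} [DecidableEq ι] {g g' : ℝ → ℂ}
    (hg : ∀ x, HasDerivAt g (g' x) x) (hg' : Continuous g') (t : ι → ℝ) (S : Finset ι) :
    Set.InjOn t S → ∀ u v : ℝ, u ≤ v → (∀ j ∈ S, t j ≠ u) → (∀ j ∈ S, t j ≠ v) →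
    ∫ x in u..v, g' x * ∏ k ∈ S, csign (t k - x)
      = g v * (∏ k ∈ S, csign (t k - v)) - g u * (∏ k ∈ S, csign (t k - u))
        + 2 * ∑ j ∈ S, if u < t j ∧ t j < v then g (t j) * ∏ k ∈ S.erase j, csign (t k - t j)
            else 0 := by
  induction S using Finset.induction_on with
  | empty =>
    intro _ u v _ _ _
    simp [intervalIntegral.integral_eq_sub_of_hasDerivAt (fun x _ => hg x)
      (hg'.intervalIntegrable u v)]
  | insert i S hi ih =>
    intro hinj u v huv hu hv
    have hinjS : Set.InjOn t S := hinj.mono (by simp)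
    have huS : ∀ j ∈ S, t j ≠ u := fun j hj => hu j (Finset.mem_insert_of_mem hj)
    have hvS : ∀ j ∈ S, t j ≠ v := fun j hj => hv j (Finset.mem_insert_of_mem hj)
    have hiS : ∀ j ∈ S, t j ≠ t i := fun j hj h => by
      have := hinj (by simp [hj]) (by simp) h
      exact hi (this ▸ hj)
    have hui := hu i (Finset.mem_insert_self _ _)
    have hvi := hv i (Finset.mem_insert_self _ _)
    have hsum : ∀ j ∈ S, ∏ k ∈ (insert i S).erase j, csign (t k - t j)
        = csign (t i - t j) * ∏ k ∈ S.erase j, csign (t k - t j) := by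
      intro j hj
      have hij : i ≠ j := fun h => hi (h ▸ hj)
      rw [Finset.erase_insert_of_ne hij, Finset.prod_insert]
      simp [hi]
    have hsum2 : (∑ j ∈ S, if u < t j ∧ t j < v then
          g (t j) * ∏ k ∈ (insert i S).erase j, csign (t k - t j) else 0)
        = ∑ j ∈ S, if u < t j ∧ t j < v then
          csign (t i - t j) * (g (t j) * ∏ k ∈ S.erase j, csign (t k - t j)) else 0 := by
      refine Finset.sum_congr rfl fun j hj => ?_
      rw [hsum j hj]
      split_ifs <;> ring
    rw [Finset.sum_insert hi, Finset.erase_insert hi, hsum2]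
    simp only [Finset.prod_insert hi]
    -- The new factor `csign (t i - x)` is `1` to the left of `t i` and `-1` to the right, so the
    -- integral is split at `t i` whenever that point lies in `(u, v)`, and the induction hypothesis
    -- is applied to each piece.
    have hI : ∀ a b : ℝ, IntervalIntegrable
        (fun x => g' x * (csign (t i - x) * ∏ k ∈ S, csign (t k - x))) volume a b := by
      intro a b
      simpa only [Finset.prod_insert hi] using
        intervalIntegrable_mul_prod_csign hg' (insert i S) t a b
    have hplus : ∀ a b : ℝ, a ≤ b → b ≤ t i →
        ∫ x in a..b, g' x * (csign (t i - x) * ∏ k ∈ S, csign (t k - x))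
          = ∫ x in a..b, g' x * ∏ k ∈ S, csign (t k - x) := by
      intro a b hab hb
      refine intervalIntegral.integral_congr_ae ?_
      -- The right endpoint is discarded because it may be `t i`, where the sign is `0`.
      filter_upwards [compl_mem_ae_iff.2 (measure_singleton (μ := volume) b)] with x hx hxm
      rw [Set.uIoc_of_le hab] at hxm
      have : x < b := lt_of_le_of_ne hxm.2 hx
      rw [csign_of_pos (by linarith), one_mul]
    have hminus : ∀ a b : ℝ, a ≤ b → t i ≤ a →
        ∫ x in a..b, g' x * (csign (t i - x) * ∏ k ∈ S, csign (t k - x))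
          = -∫ x in a..b, g' x * ∏ k ∈ S, csign (t k - x) := by
      intro a b hab ha
      rw [← intervalIntegral.integral_neg]
      refine intervalIntegral.integral_congr_ae ?_
      filter_upwards with x hxm
      rw [Set.uIoc_of_le hab] at hxm
      have := hxm.1
      rw [csign_of_neg (by linarith)]
      ring
    rcases lt_or_gt_of_ne hui with h1 | h1
    · rw [hminus u v huv h1.le, ih hinjS u v huv huS hvS, if_neg (by intro h; linarith [h.1]),
        csign_of_neg (by linarith), csign_of_neg (by linarith)]
      have : (∑ j ∈ S, if u < t j ∧ t j < v then
          csign (t i - t j) * (g (t j) * ∏ k ∈ S.erase j, csign (t k - t j)) else 0)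
          = -∑ j ∈ S, if u < t j ∧ t j < v then
            (g (t j) * ∏ k ∈ S.erase j, csign (t k - t j)) else 0 := by
        rw [← Finset.sum_neg_distrib]
        refine Finset.sum_congr rfl fun j hj => ?_
        split_ifs with h
        · rw [csign_of_neg (by linarith [h.1])]; ring
        · simp
      rw [this]; ring
    rcases lt_or_gt_of_ne hvi with h2 | h2
    · rw [← intervalIntegral.integral_add_adjacent_intervals (hI u (t i)) (hI (t i) v),
        hplus u (t i) h1.le le_rfl, hminus (t i) v h2.le le_rfl,
        ih hinjS u (t i) h1.le huS hiS, ih hinjS (t i) v h2.le hiS hvS, if_pos ⟨h1, h2⟩,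
        csign_of_neg (x := t i - v) (by linarith), csign_of_pos (x := t i - u) (by linarith)]
      have : (∑ j ∈ S, if u < t j ∧ t j < v then
          csign (t i - t j) * (g (t j) * ∏ k ∈ S.erase j, csign (t k - t j)) else 0)
          = (∑ j ∈ S, if u < t j ∧ t j < t i then
            (g (t j) * ∏ k ∈ S.erase j, csign (t k - t j)) else 0)
          - ∑ j ∈ S, if t i < t j ∧ t j < v then
            (g (t j) * ∏ k ∈ S.erase j, csign (t k - t j)) else 0 := by
        rw [← Finset.sum_sub_distrib]
        refine Finset.sum_congr rfl fun j hj => ?_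
        rcases lt_or_gt_of_ne (hiS j hj) with h | h
        · rw [csign_of_pos (by linarith), if_neg (c := t i < t j ∧ t j < v)
            (by intro h'; linarith [h'.1])]
          have : t j < v := h.trans h2
          simp [h, this]
        · rw [csign_of_neg (by linarith), if_neg (c := u < t j ∧ t j < t i)
            (by intro h'; linarith [h'.2])]
          have : u < t j := h1.trans h
          simp only [h, this, true_and]
          split_ifs <;> ring
      rw [this]; ring
    · rw [hplus u v huv h2.le, ih hinjS u v huv huS hvS, if_neg (by intro h; linarith [h.2]),
        csign_of_pos (by linarith), csign_of_pos (by linarith)]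
      have : (∑ j ∈ S, if u < t j ∧ t j < v then
          csign (t i - t j) * (g (t j) * ∏ k ∈ S.erase j, csign (t k - t j)) else 0)
          = ∑ j ∈ S, if u < t j ∧ t j < v then
            (g (t j) * ∏ k ∈ S.erase j, csign (t k - t j)) else 0 := by
        refine Finset.sum_congr rfl fun j hj => ?_
        split_ifs with h
        · rw [csign_of_pos (by linarith [h.2])]; ring
        · simp
      rw [this]; ring

/-! ### Fourier coefficients of the order sign. -/

/-- Lebesgue measure on the open box `(0, 2π)^n`. -/
noncomputable def boxMeasure (n : ℕ) : Measure (Fin n → ℝ) :=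
  Measure.pi fun _ => volume.restrict (Set.Ioo 0 (2 * Real.pi))

instance (n : ℕ) : IsFiniteMeasure (boxMeasure n) := by
  unfold boxMeasure; infer_instance

/-- The function `e^{imx/2}`. -/
noncomputable def halfExp (m : ℤ) (x : ℝ) : ℂ := Complex.exp (Complex.I * m / 2 * x)

/-- The sign of the permutation which sorts `θ`, zero if two entries coincide. -/
noncomputable def ordSign {n : ℕ} (θ : Fin n → ℝ) : ℂ :=
  ∏ j : Fin n, ∏ k ∈ Finset.Ioi j, csign (θ k - θ j)

/-- The Fourier coefficients of the function `ordSign`. -/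
noncomputable def signFourier {n : ℕ} (p : Fin n → ℤ) : ℂ :=
  ∫ θ, (∏ j, halfExp (p j) (θ j)) * ordSign θ ∂(boxMeasure n)

/-- The faces of the box are null. The open box is convenient because the integration by parts needs
angles different from `0` and `2π`. -/
theorem angleMeasure_eq (N : ℕ) : angleMeasure N = boxMeasure N := by
  unfold angleMeasure boxMeasure
  rw [volume_pi, Measure.restrict_pi_pi]
  congr 1
  funext i
  exact Measure.restrict_congr_set Ioo_ae_eq_Ico.symm

theorem ae_boxMeasure (n : ℕ) : ∀ᵐ θ ∂(boxMeasure n), ∀ j, θ j ∈ Set.Ioo 0 (2 * Real.pi) := by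
  unfold boxMeasure
  rw [← Measure.restrict_pi_pi]
  filter_upwards [ae_restrict_mem (MeasurableSet.univ_pi fun _ => measurableSet_Ioo)] with θ hθ j
  exact hθ j (Set.mem_univ j)

theorem integral_boxMeasure_perm {n : ℕ} (σ : Equiv.Perm (Fin n)) (f : (Fin n → ℝ) → ℂ) :
    ∫ θ, f (fun j => θ (σ j)) ∂(boxMeasure n) = ∫ θ, f θ ∂(boxMeasure n) := by
  have h := measurePreserving_piCongrLeft
    (fun _ : Fin n => (volume : Measure ℝ).restrict (Set.Ioo 0 (2 * Real.pi))) σ.symm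
  have h2 := h.integral_comp' (g := f)
  unfold boxMeasure
  rw [← h2]
  congr 1
  funext θ
  congr 1
  funext j
  have := MeasurableEquiv.piCongrLeft_apply_apply (β := fun _ : Fin n => ℝ) (e := σ.symm) (x := θ)
    (i := σ j)
  simpa using this.symm

theorem integral_boxMeasure_insertNth {n : ℕ} (i : Fin (n + 1)) {f : (Fin (n + 1) → ℝ) → ℂ}
    (hf : Integrable f (boxMeasure (n + 1))) :
    ∫ θ, f θ ∂(boxMeasure (n + 1))
      = ∫ t, (∫ x in Set.Ioo 0 (2 * Real.pi), f (i.insertNth x t)) ∂(boxMeasure n) := by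
  have h := (measurePreserving_piFinSuccAbove
    (fun _ : Fin (n + 1) => (volume : Measure ℝ).restrict (Set.Ioo 0 (2 * Real.pi))) i).symm
  have h2 := h.integral_comp' (g := f)
  have h3 := (h.integrable_comp_emb (MeasurableEquiv.measurableEmbedding _) (g := f)).2 hf
  unfold boxMeasure at hf ⊢
  rw [← h2]
  exact integral_prod_symm _ h3

theorem halfExp_add (m l : ℤ) (x : ℝ) : halfExp (m + l) x = halfExp m x * halfExp l x := by
  unfold halfExp
  rw [← Complex.exp_add]
  congr 1
  push_cast
  ring

@[simp] theorem halfExp_zero (x : ℝ) : halfExp 0 x = 1 := by simp [halfExp]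

theorem norm_halfExp (m : ℤ) (x : ℝ) : ‖halfExp m x‖ = 1 := by
  unfold halfExp
  rw [show Complex.I * m / 2 * x = ((m / 2 * x : ℝ) : ℂ) * Complex.I by push_cast; ring]
  exact Complex.norm_exp_ofReal_mul_I _

theorem continuous_halfExp (m : ℤ) : Continuous (halfExp m) := by
  unfold halfExp; fun_prop

theorem hasDerivAt_halfExp {m : ℤ} (hm : m ≠ 0) (x : ℝ) :
    HasDerivAt (fun x => 2 / (Complex.I * m) * halfExp m x) (halfExp m x) x := by
  have hm' : (m : ℂ) ≠ 0 := by exact_mod_cast hm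
  have h1 : HasDerivAt (fun x : ℝ => Complex.I * m / 2 * (x : ℂ)) (Complex.I * m / 2 * 1) x :=
    (Complex.ofRealCLM.hasDerivAt (x := x)).const_mul _
  have h2 := (h1.cexp).const_mul (2 / (Complex.I * m))
  refine h2.congr_deriv ?_
  unfold halfExp
  field_simp [Complex.I_ne_zero]

theorem halfExp_two_pi (m : ℤ) : halfExp m (2 * Real.pi) = (-1) ^ m := by
  unfold halfExp
  rw [← Complex.exp_pi_mul_I, ← Complex.exp_int_mul]
  congr 1
  push_cast
  ring

@[simp] theorem halfExp_apply_zero (m : ℤ) : halfExp m 0 = 1 := by simp [halfExp]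

/-- For even `m` the function `e^{imx/2}` is `2π`-periodic, so this is the usual orthogonality of
characters. -/
theorem integral_halfExp_of_even {m : ℤ} (hm : Even m) :
    ∫ x in Set.Ioo 0 (2 * Real.pi), halfExp m x = if m = 0 then 2 * (Real.pi : ℂ) else 0 := by
  have hpi : (0 : ℝ) ≤ 2 * Real.pi := by positivity
  rw [← integral_Ioc_eq_integral_Ioo, ← intervalIntegral.integral_of_le hpi]
  split_ifs with h
  · subst h; simp
  · rw [intervalIntegral.integral_eq_sub_of_hasDerivAt (fun x _ => hasDerivAt_halfExp h x)
      ((continuous_halfExp m).intervalIntegrable _ _), halfExp_two_pi, halfExp_apply_zero,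
      hm.neg_one_zpow, sub_self]

theorem ordSign_eq {n : ℕ} (θ : Fin n → ℝ) : ordSign θ = csign (Matrix.vandermonde θ).det := by
  rw [Matrix.det_vandermonde, map_prod]
  simp only [map_prod]
  rfl

theorem ordSign_perm {n : ℕ} (σ : Equiv.Perm (Fin n)) (θ : Fin n → ℝ) :
    ordSign (fun j => θ (σ j)) = ((Equiv.Perm.sign σ : ℤ) : ℂ) * ordSign θ := by
  rw [ordSign_eq, ordSign_eq]
  have : Matrix.vandermonde (fun j => θ (σ j)) = (Matrix.vandermonde θ).submatrix σ id := rfl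
  rw [this, Matrix.det_permute, map_mul]
  congr 1
  rcases Int.units_eq_one_or (Equiv.Perm.sign σ) with h | h <;> rw [h]
  · simp
  · simp [csign_neg]

theorem ordSign_cons {n : ℕ} (x : ℝ) (t : Fin n → ℝ) :
    ordSign (Fin.cons x t : Fin (n + 1) → ℝ) = (∏ k, csign (t k - x)) * ordSign t := by
  unfold ordSign
  rw [Fin.prod_univ_succ]
  congr 1
  · rw [Fin.Ioi_zero_eq_map, Finset.prod_map]
    rfl
  · refine Finset.prod_congr rfl fun j _ => ?_
    rw [Fin.Ioi_succ, Finset.prod_map]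
    rfl

/-- Bringing the `i`-th entry to the front is a cycle of sign `(-1)^i`, which reduces to
`ordSign_cons`. -/
theorem ordSign_insertNth {n : ℕ} (i : Fin (n + 1)) (x : ℝ) (t : Fin n → ℝ) :
    ordSign (i.insertNth x t : Fin (n + 1) → ℝ)
      = (-1) ^ (i : ℕ) * (∏ k, csign (t k - x)) * ordSign t := by
  have h := ordSign_perm i.cycleRange.symm (i.insertNth x t : Fin (n + 1) → ℝ)
  have h2 := Fin.insertNth_comp_cycleRange_symm i x t
  have h3 : (fun j => (i.insertNth x t : Fin (n + 1) → ℝ) (i.cycleRange.symm j)) = Fin.cons x t :=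
    h2
  rw [h3, ordSign_cons, Equiv.Perm.sign_symm, Fin.sign_cycleRange] at h
  push_cast at h
  rw [mul_assoc, h, ← mul_assoc, ← mul_pow]
  simp

theorem measurable_ordSign {n : ℕ} : Measurable (ordSign : (Fin n → ℝ) → ℂ) := by
  unfold ordSign
  refine Finset.measurable_prod _ fun j _ => Finset.measurable_prod _ fun k _ => ?_
  exact measurable_csign.comp ((measurable_pi_apply k).sub (measurable_pi_apply j))

theorem norm_ordSign_le {n : ℕ} (θ : Fin n → ℝ) : ‖ordSign θ‖ ≤ 1 := by
  rw [ordSign_eq]; exact norm_csign_le _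

theorem injective_of_ordSign_ne_zero {n : ℕ} {θ : Fin n → ℝ} (h : ordSign θ ≠ 0) :
    Function.Injective θ := by
  rw [ordSign_eq] at h
  rw [← Matrix.det_vandermonde_ne_zero_iff]
  intro h0
  rw [h0] at h
  simp at h

theorem measurable_prod_halfExp {n : ℕ} (p : Fin n → ℤ) :
    Measurable fun θ : Fin n → ℝ => ∏ j, halfExp (p j) (θ j) :=
  Finset.measurable_prod _ fun j _ => (continuous_halfExp _).measurable.comp (measurable_pi_apply j)

theorem norm_prod_halfExp {n : ℕ} (p : Fin n → ℤ) (θ : Fin n → ℝ) :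
    ‖∏ j, halfExp (p j) (θ j)‖ = 1 := by
  rw [norm_prod]; simp [norm_halfExp]

theorem integrable_boxMeasure_of_bound {n : ℕ} {f : (Fin n → ℝ) → ℂ} (hf : Measurable f) {C : ℝ}
    (hC : ∀ θ, ‖f θ‖ ≤ C) : Integrable f (boxMeasure n) :=
  Integrable.of_bound hf.aestronglyMeasurable C (Filter.Eventually.of_forall hC)

theorem integrable_prod_halfExp_mul_ordSign {n : ℕ} (p : Fin n → ℤ) :
    Integrable (fun θ => (∏ j, halfExp (p j) (θ j)) * ordSign θ) (boxMeasure n) := by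
  refine integrable_boxMeasure_of_bound ((measurable_prod_halfExp p).mul measurable_ordSign)
    (C := 1) fun θ => ?_
  rw [norm_mul, norm_prod_halfExp, one_mul]
  exact norm_ordSign_le θ

/-- The box is invariant under relabelling and `ordSign` is alternating, so the coefficient is
alternating in the exponents. -/
theorem signFourier_perm {n : ℕ} (σ : Equiv.Perm (Fin n)) (p : Fin n → ℤ) :
    signFourier (fun j => p (σ j)) = ((Equiv.Perm.sign σ : ℤ) : ℂ) * signFourier p := by
  unfold signFourier
  rw [← integral_boxMeasure_perm σ, ← integral_const_mul]
  congr 1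
  funext θ
  rw [ordSign_perm, Equiv.prod_comp σ (fun j => halfExp (p j) (θ j))]
  ring

theorem signFourier_eq_zero_of_not_injective {n : ℕ} {p : Fin n → ℤ}
    (hp : ¬Function.Injective p) : signFourier p = 0 := by
  simp only [Function.Injective, not_forall] at hp
  obtain ⟨a, b, hab, hne⟩ := hp
  have h := signFourier_perm (Equiv.swap a b) p
  have h2 : (fun j => p (Equiv.swap a b j)) = p := by
    funext j
    rcases eq_or_ne j a with rfl | hja
    · simp [hab]
    rcases eq_or_ne j b with rfl | hjb
    · simp [hab]
    · rw [Equiv.swap_apply_of_ne_of_ne hja hjb]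
  rw [h2, Equiv.Perm.sign_swap hne] at h
  push_cast at h
  have h3 : (2 : ℂ) * signFourier p = 0 := by linear_combination h
  simpa using h3

/-- At `2π` the exponential is `(-1)^m` and the product of signs is `(-1)^n`; at `0` both are `1`.
The parity hypothesis makes the boundary terms cancel, and only the jumps at the points `t j`
remain. -/
theorem integral_halfExp_mul_prod_csign {n : ℕ} {m : ℤ} (hm : m ≠ 0) (hpar : Even (m + n))
    {t : Fin n → ℝ} (ht : Function.Injective t) (ht' : ∀ j, t j ∈ Set.Ioo 0 (2 * Real.pi)) :
    ∫ x in Set.Ioo 0 (2 * Real.pi), halfExp m x * ∏ k, csign (t k - x)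
      = 4 / (Complex.I * m) * ∑ j, halfExp m (t j) * ∏ k ∈ Finset.univ.erase j,
          csign (t k - t j) := by
  have hpi : (0 : ℝ) ≤ 2 * Real.pi := by positivity
  rw [← integral_Ioc_eq_integral_Ioo, ← intervalIntegral.integral_of_le hpi,
    integral_deriv_mul_prod_csign (fun x => hasDerivAt_halfExp hm x) (continuous_halfExp m) t
      Finset.univ ht.injOn _ _ hpi (fun j _ => (ht' j).1.ne') (fun j _ => (ht' j).2.ne),
    halfExp_two_pi, halfExp_apply_zero]
  have h1 : ∏ k, csign (t k - 2 * Real.pi) = (-1 : ℂ) ^ n := by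
    rw [Finset.prod_congr rfl fun k _ => csign_of_neg (sub_neg.2 (ht' k).2)]
    simp
  have h2 : ∏ k, csign (t k - 0) = (1 : ℂ) := by
    rw [Finset.prod_congr rfl fun k _ => csign_of_pos (sub_pos.2 (ht' k).1)]
    simp
  have h3 : ((-1 : ℂ)) ^ m * (-1) ^ n = 1 := by
    rw [← zpow_natCast, ← zpow_add₀ (by norm_num), hpar.neg_one_zpow]
  have h4 : (∑ j, if 0 < t j ∧ t j < 2 * Real.pi then
      2 / (Complex.I * m) * halfExp m (t j) * ∏ k ∈ Finset.univ.erase j, csign (t k - t j) else 0)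
      = 2 / (Complex.I * m) * ∑ j, halfExp m (t j) * ∏ k ∈ Finset.univ.erase j,
          csign (t k - t j) := by
    rw [Finset.mul_sum]
    refine Finset.sum_congr rfl fun j _ => ?_
    rw [if_pos ⟨(ht' j).1, (ht' j).2⟩]
    ring
  rw [h1, h2, h4]
  linear_combination (2 / (Complex.I * m)) * h3

/-- The recursion for the Fourier coefficients, expanding along the first variable. -/
theorem signFourier_expand {n : ℕ} (p : Fin (n + 2) → ℤ) (hpar : ∀ j, Even (p j + (n + 1 : ℕ)))
    (h0 : p 0 ≠ 0) :
    signFourier p = 8 * Real.pi / (Complex.I * p 0) * ∑ j : Fin (n + 1),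
      if p 0 + p j.succ = 0 then
        (-1) ^ (j : ℕ) * signFourier (fun k => p (j.succAbove k).succ) else 0 := by
  set F : Fin (n + 1) → (Fin (n + 1) → ℝ) → ℂ := fun j t =>
    halfExp (p 0) (t j) * (∏ k ∈ Finset.univ.erase j, csign (t k - t j))
      * ((∏ k, halfExp (p k.succ) (t k)) * ordSign t) with hF
  have hFint : ∀ j, Integrable (F j) (boxMeasure (n + 1)) := by
    intro j
    refine integrable_boxMeasure_of_bound (C := 1) ?_ fun t => ?_
    · refine Measurable.mul (Measurable.mul ((continuous_halfExp _).measurable.comp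
        (measurable_pi_apply j)) (Finset.measurable_prod _ fun k _ => ?_))
        ((measurable_prod_halfExp _).mul measurable_ordSign)
      exact measurable_csign.comp ((measurable_pi_apply k).sub (measurable_pi_apply j))
    · simp only [hF, norm_mul, norm_halfExp, norm_prod_halfExp, one_mul]
      exact mul_le_one₀ (norm_prod_csign_le _ _) (norm_nonneg _) (norm_ordSign_le t)
  -- Integrating out the zeroth angle leaves one jump term for each of the remaining angles.
  have key : signFourier p = 4 / (Complex.I * p 0) * ∑ j, ∫ t, F j t ∂(boxMeasure (n + 1)) := by
    unfold signFourier
    rw [integral_boxMeasure_insertNth 0 (integrable_prod_halfExp_mul_ordSign p),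
      ← integral_finsetSum _ fun j _ => hFint j, ← integral_const_mul]
    refine integral_congr_ae ?_
    filter_upwards [ae_boxMeasure (n + 1)] with t ht
    have h1 : ∀ x : ℝ, (∏ j, halfExp (p j) ((Fin.insertNth 0 x t : Fin (n + 2) → ℝ) j))
        * ordSign (Fin.insertNth 0 x t : Fin (n + 2) → ℝ)
        = halfExp (p 0) x * (∏ k, csign (t k - x))
          * ((∏ k, halfExp (p k.succ) (t k)) * ordSign t) := by
      intro x
      rw [ordSign_insertNth, Fin.prod_univ_succ]
      simp only [Fin.insertNth_zero', Fin.cons_zero, Fin.cons_succ]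
      simp
      ring
    simp only [h1]
    rw [integral_mul_const]
    -- Where two angles coincide both sides vanish; elsewhere `t` is injective, as the integration
    -- by parts requires.
    by_cases hs : ordSign t = 0
    · simp [hF, hs]
    · rw [integral_halfExp_mul_prod_csign h0 (hpar 0) (injective_of_ordSign_ne_zero hs) ht]
      simp only [hF]
      rw [mul_assoc, Finset.sum_mul]
  -- In the `j`-th term the product of signs around the `j`-th angle occurs twice, once from the
  -- jump and once from `ordSign`, so it squares to `1` almost everywhere. What remains in that
  -- angle is a single exponential of even exponent `p 0 + p j.succ`, whose integral is `2π` or `0`.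
  have hFj : ∀ j, ∫ t, F j t ∂(boxMeasure (n + 1)) = if p 0 + p j.succ = 0 then
      2 * Real.pi * ((-1) ^ (j : ℕ) * signFourier (fun k => p (j.succAbove k).succ)) else 0 := by
    intro j
    rw [integral_boxMeasure_insertNth j (hFint j)]
    have hev : Even (p 0 + p j.succ) := by
      have := (hpar 0).add (hpar j.succ)
      rw [Int.even_iff] at this ⊢
      omega
    have h1 : ∀ t : Fin n → ℝ, ∫ x in Set.Ioo 0 (2 * Real.pi), F j (j.insertNth x t)
        = (∫ x in Set.Ioo 0 (2 * Real.pi), halfExp (p 0 + p j.succ) x)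
          * ((-1) ^ (j : ℕ) * ((∏ k, halfExp (p (j.succAbove k).succ) (t k)) * ordSign t)) := by
      intro t
      rw [← integral_mul_const]
      refine integral_congr_ae (ae_restrict_of_ae ?_)
      have hfin : (Set.range t).Finite := Set.finite_range t
      filter_upwards [compl_mem_ae_iff.2 (hfin.measure_zero volume)] with x hx
      have hsq : (∏ k, csign (t k - x)) * (∏ k, csign (t k - x)) = 1 := by
        rw [← Finset.prod_mul_distrib]
        refine Finset.prod_eq_one fun k _ => csign_mul_self ?_
        intro h
        exact hx ⟨k, by linarith⟩
      have hprod : ∏ k ∈ Finset.univ.erase j, csign ((j.insertNth x t : Fin (n + 1) → ℝ) k - x)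
          = ∏ k, csign (t k - x) := by
        have : (Finset.univ.erase j) = Finset.univ.map (Fin.succAboveEmb j) := by
          ext k
          simp only [Finset.mem_erase, Finset.mem_univ, and_true, Finset.mem_map, true_and]
          exact Fin.exists_succAbove_eq_iff.symm
        rw [this, Finset.prod_map]
        simp
      simp only [hF, Fin.insertNth_apply_same, hprod, ordSign_insertNth]
      rw [Fin.prod_univ_succAbove _ j]
      simp only [Fin.insertNth_apply_same, Fin.insertNth_apply_succAbove]
      rw [halfExp_add]
      linear_combination (halfExp (p 0) x * halfExp (p j.succ) x * (-1) ^ (j : ℕ)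
        * ((∏ k, halfExp (p (j.succAbove k).succ) (t k)) * ordSign t)) * hsq
    simp only [h1]
    rw [integral_const_mul, integral_const_mul, integral_halfExp_of_even hev]
    unfold signFourier
    split_ifs <;> simp
  rw [key]
  simp only [hFj]
  rw [Finset.mul_sum, Finset.mul_sum]
  refine Finset.sum_congr rfl fun j _ => ?_
  split_ifs
  · ring
  · simp

/-- After moving `a` to the front, every term of the recursion vanishes. A single variable is
treated directly, since the recursion needs two. -/
theorem signFourier_eq_zero_of_no_partner {n : ℕ} {p : Fin n → ℤ}
    (hpar : ∀ j, Odd (p j + n)) (a : Fin n) (ha : p a ≠ 0) (h : ∀ j, p a + p j ≠ 0) :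
    signFourier p = 0 := by
  match n, p, a with
  | 1, p, a =>
    obtain rfl : a = 0 := Subsingleton.elim _ _
    have hev : Even (p 0) := by
      have := hpar 0
      rw [Int.odd_iff] at this
      rw [Int.even_iff]
      push_cast at this
      omega
    unfold signFourier
    rw [integral_boxMeasure_insertNth 0 (integrable_prod_halfExp_mul_ordSign p)]
    have h1 : ∀ t : Fin 0 → ℝ, ∫ x in Set.Ioo 0 (2 * Real.pi),
        (∏ j, halfExp (p j) ((Fin.insertNth 0 x t : Fin 1 → ℝ) j))
          * ordSign (Fin.insertNth 0 x t : Fin 1 → ℝ)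
        = ∫ x in Set.Ioo 0 (2 * Real.pi), halfExp (p 0) x := by
      intro t
      simp [ordSign]
    simp only [h1]
    rw [integral_halfExp_of_even hev, if_neg ha]
    simp
  | n + 2, p, a =>
    have hs := signFourier_perm (Equiv.swap 0 a) p
    rw [signFourier_expand] at hs
    · rw [Finset.sum_eq_zero, mul_zero] at hs
      · rcases Int.units_eq_one_or (Equiv.Perm.sign (Equiv.swap 0 a)) with h | h <;>
          rw [h] at hs <;> simpa using hs.symm
      · intro j _
        rw [if_neg]
        rw [Equiv.swap_apply_left]
        exact h _
    · intro j
      have := hpar (Equiv.swap 0 a j)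
      rw [Int.odd_iff] at this
      rw [Int.even_iff]
      push_cast at this ⊢
      omega
    · rwa [Equiv.swap_apply_left]

/-- Expanding along `a`, injectivity leaves only the partner `b`. The prefactor is `8π/(i p a)` and
the remaining coefficient does not involve the pair, so `p a * signFourier p` does not depend on the
value of the pair. -/
theorem signFourier_replace_pair {n : ℕ} {p q : Fin n → ℤ} (hp : ∀ j, Odd (p j + n))
    (hq : ∀ j, Odd (q j + n)) (hpi : Function.Injective p) (hqi : Function.Injective q)
    {a b : Fin n} (hab : a ≠ b) (hpa : p a ≠ 0) (hqa : q a ≠ 0) (hpb : p b = -p a)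
    (hqb : q b = -q a) (hpq : ∀ j, j ≠ a → j ≠ b → p j = q j) :
    (p a : ℂ) * signFourier p = q a * signFourier q := by
  match n, p, q, a, b with
  | 1, _, _, a, b => exact absurd (Subsingleton.elim a b) hab
  | n + 2, p, q, a, b =>
    set σ := Equiv.swap 0 a with hσ
    have hσb : σ b ≠ 0 := by
      intro h
      have : b = σ 0 := by rw [← h, hσ, Equiv.swap_apply_self]
      rw [hσ, Equiv.swap_apply_left] at this
      exact hab this.symm
    obtain ⟨j0, hj0⟩ := Fin.exists_succ_eq.2 hσb
    have hσj0 : σ j0.succ = b := by rw [hj0, hσ, Equiv.swap_apply_self]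
    have hσ0 : σ 0 = a := Equiv.swap_apply_left _ _
    -- The right-hand side sees `r` only away from `a` and `b`, so it is the same for `p` and `q`.
    have main : ∀ r : Fin (n + 2) → ℤ, (∀ j, Odd (r j + (n + 2 : ℕ))) → Function.Injective r →
        r a ≠ 0 → r b = -r a → ((Equiv.Perm.sign σ : ℤ) : ℂ) * ((r a : ℂ) * signFourier r)
          = 8 * Real.pi / Complex.I * ((-1) ^ (j0 : ℕ)
            * signFourier (fun k => r (σ (j0.succAbove k).succ))) := by
      intro r hr hri hra hrb
      have hs := signFourier_perm σ r
      have hra' : (r a : ℂ) ≠ 0 := by exact_mod_cast hra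
      rw [signFourier_expand] at hs
      · rw [Finset.sum_eq_single j0] at hs
        · rw [hσj0, hσ0, hrb, if_pos (by ring)] at hs
          rw [mul_left_comm, ← hs]
          field_simp
        · intro j _ hj
          rw [if_neg]
          rw [hσ0]
          intro h
          have : r (σ j.succ) = r b := by rw [hrb]; linarith
          have := hri this
          rw [← hσj0] at this
          exact hj (Fin.succ_injective _ (σ.injective this))
        · intro h; exact absurd (Finset.mem_univ _) h
      · intro j
        have := hr (σ j)
        rw [Int.odd_iff] at this
        rw [Int.even_iff]
        push_cast at this ⊢
        omega
      · rwa [hσ0]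
    have hrest : (fun k => p (σ (j0.succAbove k).succ)) = fun k => q (σ (j0.succAbove k).succ) := by
      funext k
      refine hpq _ ?_ ?_
      · rw [← hσ0]
        exact fun h => Fin.succ_ne_zero _ (σ.injective h)
      · rw [← hσj0]
        exact fun h => Fin.succAbove_ne j0 k (Fin.succ_injective _ (σ.injective h))
    have h1 := main p hp hpi hpa hpb
    have h2 := main q hq hqi hqa hqb
    rw [hrest, ← h2] at h1
    refine mul_left_cancel₀ ?_ h1
    rcases Int.units_eq_one_or (Equiv.Perm.sign σ) with h | h <;> rw [h] <;> simp

/-! ### The base exponents and their shifts. -/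

/-- The doubled exponents `-(N - 1), -(N - 3), …, N - 1` of the antisymmetrised Vandermonde
product. -/
def baseExp (N : ℕ) (j : Fin N) : ℤ := 2 * (j : ℤ) + 1 - N

theorem odd_baseExp_add (N : ℕ) (j : Fin N) : Odd (baseExp N j + N) :=
  ⟨j, by unfold baseExp; ring⟩

theorem baseExp_injective (N : ℕ) : Function.Injective (baseExp N) := by
  intro i j h
  unfold baseExp at h
  ext
  omega

/-- The lowest exponent pairs only with the highest, and removing both leaves the base exponents for
two fewer particles. -/
theorem signFourier_baseExp_ne_zero : ∀ N : ℕ, signFourier (baseExp N) ≠ 0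
  | 0 => by
    have h : ∀ θ : Fin 0 → ℝ, (∏ j, halfExp (baseExp 0 j) (θ j)) * ordSign θ = 1 := by
      intro θ; simp [ordSign]
    unfold signFourier
    simp only [h]
    simp [boxMeasure, Measure.real]
  | 1 => by
    have h : ∀ θ : Fin 1 → ℝ, (∏ j, halfExp (baseExp 1 j) (θ j)) * ordSign θ = 1 := by
      intro θ; simp [ordSign, baseExp]
    unfold signFourier
    simp only [h]
    simp [boxMeasure, Measure.real, Measure.pi_univ]
    exact ENNReal.toReal_ne_zero.2 ⟨by simp [Real.pi_pos], by simp⟩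
  | n + 2 => by
    have h0 : baseExp (n + 2) 0 ≠ 0 := by
      unfold baseExp; push_cast [Fin.val_zero]; omega
    rw [signFourier_expand _ _ h0, Finset.sum_eq_single (Fin.last n)]
    · rw [if_pos]
      · have hrest : (fun k => baseExp (n + 2) ((Fin.last n).succAbove k).succ) = baseExp n := by
          funext k
          simp only [Fin.succAbove_last, baseExp, Fin.val_succ, Fin.val_castSucc]
          push_cast
          ring
        rw [hrest]
        have h0' : ((baseExp (n + 2) 0 : ℤ) : ℂ) ≠ 0 := by exact_mod_cast h0
        refine mul_ne_zero (div_ne_zero ?_ (mul_ne_zero Complex.I_ne_zero h0')) (mul_ne_zero ?_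
          (signFourier_baseExp_ne_zero n))
        · simp [Real.pi_ne_zero]
        · simp
      · simp only [baseExp, Fin.val_succ, Fin.val_last, Fin.val_zero]
        push_cast
        ring
    · intro j _ hj
      rw [if_neg]
      simp only [baseExp, Fin.val_succ, Fin.val_zero]
      intro h
      apply hj
      ext
      rw [Fin.val_last]
      push_cast at h
      omega
    · intro h; exact absurd (Finset.mem_univ _) h
    · intro j
      have := odd_baseExp_add (n + 2) j
      rw [Int.odd_iff] at this
      rw [Int.even_iff]
      push_cast at this ⊢
      omega

/-- A nonzero coefficient forces the exponents to be distinct and their set closed under negation,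
so they cancel in pairs. -/
theorem sum_eq_zero_of_signFourier_ne_zero {n : ℕ} {p : Fin n → ℤ} (hpar : ∀ j, Odd (p j + n))
    (h : signFourier p ≠ 0) : ∑ j, p j = 0 := by
  have hinj : Function.Injective p := by
    by_contra hc
    exact h (signFourier_eq_zero_of_not_injective hc)
  have hpart : ∀ a, ∃ j, p j = -p a := by
    intro a
    by_contra! hc
    have ha : p a ≠ 0 := fun h0 => hc a (by rw [h0]; simp)
    exact h (signFourier_eq_zero_of_no_partner hpar a ha fun j hj => hc j (by linarith))
  rw [← Finset.sum_image (s := Finset.univ) (f := fun x : ℤ => x) (g := p) hinj.injOn]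
  refine Finset.sum_involution (fun x _ => -x) ?_ ?_ ?_ ?_
  · intro x _; ring
  · intro x _ hx; omega
  · intro x hx
    rw [Finset.mem_image] at hx ⊢
    obtain ⟨a, _, rfl⟩ := hx
    obtain ⟨j, hj⟩ := hpart a
    exact ⟨j, Finset.mem_univ _, hj⟩
  · intro x _; ring

/-- The exponents of the base configuration, with one entry raised and one entry lowered. -/
def shiftExp (N : ℕ) (k l : ℕ) (a b j : Fin N) : ℤ :=
  baseExp N j + ((if j = a then 2 * (k : ℤ) else 0) + (if j = b then -2 * (l : ℤ) else 0))

theorem odd_shiftExp_add (N k l : ℕ) (a b j : Fin N) : Odd (shiftExp N k l a b j + N) := by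
  have := odd_baseExp_add N j
  unfold shiftExp
  rw [Int.odd_iff] at this ⊢
  split_ifs <;> omega

theorem signFourier_shiftExp_of_ne {N k l : ℕ} (hkl : k ≠ l) (a b : Fin N) :
    signFourier (shiftExp N k l a b) = 0 := by
  by_contra h
  have h1 := sum_eq_zero_of_signFourier_ne_zero (odd_shiftExp_add N k l a b) h
  have h2 := sum_eq_zero_of_signFourier_ne_zero (odd_baseExp_add N) (signFourier_baseExp_ne_zero N)
  unfold shiftExp at h1
  rw [Finset.sum_add_distrib, Finset.sum_add_distrib, h2] at h1
  simp at h1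
  omega

/-- If `N ≤ a + k`, the raised exponent leaves the base range. The exponents can still pair off only
when the lowering undoes it (`b = a`) or acts on the mirror image (`b = a.rev`), which replaces the
pair `±m` by `±(m + 2k)` and gives the ratio `m/(m + 2k)`. If `a + k < N`, the raised exponent
collides with that of `a + k`; the terms `b = a` and `b = a + k` differ by a transposition and
cancel, and all others have a repeated exponent. -/
theorem sum_signFourier_shiftExp {N k : ℕ} (hk : 1 ≤ k) (a : Fin N) :
    ∑ b, signFourier (shiftExp N k k a b) = signFourier (baseExp N)
      * if N ≤ a + k then 1 + (baseExp N a : ℂ) / (baseExp N a + 2 * k) else 0 := by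
  have hdiag : signFourier (shiftExp N k k a a) = signFourier (baseExp N) := by
    congr 1
    funext j
    unfold shiftExp
    split_ifs <;> ring
  have ha := a.isLt
  split_ifs with hak
  · have hbase : ∀ j : Fin N, baseExp N j = 2 * (j : ℤ) + 1 - N := fun _ => rfl
    have hzero : ∀ b, b ≠ a → b ≠ a.rev → signFourier (shiftExp N k k a b) = 0 := by
      intro b hba hbr
      -- The unpaired index is `a.rev`, whose partner was raised. If `a` is the middle index, with
      -- exponent `0`, the unpaired index is instead `b.rev`, whose partner was lowered.
      by_cases h0 : a.rev = a
      · have hrev : (a : ℕ) = N - (a + 1) := by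
          conv_lhs => rw [← h0]
          exact Fin.val_rev a
        have hv : (b : ℕ) ≠ a := fun h => hba (Fin.ext h)
        have hvr : ((b.rev : Fin N) : ℕ) = N - (b + 1) := Fin.val_rev b
        have hb := b.isLt
        have h1 : b.rev ≠ a := fun h => by have := congrArg Fin.val h; omega
        have h2 : b.rev ≠ b := fun h => by have := congrArg Fin.val h; omega
        have hval : shiftExp N k k a b b.rev = -baseExp N b := by
          simp only [shiftExp, if_neg h1, if_neg h2, hbase]; omega
        refine signFourier_eq_zero_of_no_partner (odd_shiftExp_add N k k a b) b.rev ?_ fun j => ?_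
        · rw [hval, hbase]; omega
        · rw [hval]
          have hj := j.isLt
          simp only [shiftExp, hbase, Fin.ext_iff]
          split_ifs <;> omega
      · have hvr : ((a.rev : Fin N) : ℕ) = N - (a + 1) := Fin.val_rev a
        have hv : (a.rev : ℕ) ≠ a := fun h => h0 (Fin.ext h)
        have hval : shiftExp N k k a b a.rev = -baseExp N a := by
          simp only [shiftExp, if_neg h0, if_neg (Ne.symm hbr), hbase]; omega
        refine signFourier_eq_zero_of_no_partner (odd_shiftExp_add N k k a b) a.rev ?_ fun j => ?_
        · rw [hval, hbase]; omega
        · rw [hval]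
          have hj := j.isLt
          have hb := b.isLt
          have hba' : (b : ℕ) ≠ a := fun h => hba (Fin.ext h)
          simp only [shiftExp, hbase, Fin.ext_iff]
          split_ifs <;> omega
    have hvr : ((a.rev : Fin N) : ℕ) = N - (a + 1) := Fin.val_rev a
    by_cases h0 : a.rev = a
    · have hrev : (a : ℕ) = N - (a + 1) := by
        conv_lhs => rw [← h0]
        exact hvr
      have hb0 : baseExp N a = 0 := by rw [hbase]; omega
      rw [Finset.sum_eq_single a (fun b _ hb => hzero b hb (by rwa [h0]))
        (fun h => absurd (Finset.mem_univ _) h), hdiag, hb0]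
      simp
    · have hv : (a.rev : ℕ) ≠ a := fun h => h0 (Fin.ext h)
      rw [Finset.sum_eq_add a a.rev (Ne.symm h0) (fun b _ hb => hzero b hb.1 hb.2)
        (fun h => absurd (Finset.mem_univ _) h) (fun h => absurd (Finset.mem_univ _) h), hdiag]
      have hsa : shiftExp N k k a a.rev a = baseExp N a + 2 * k := by
        simp only [shiftExp, if_neg (Ne.symm h0), if_true]; ring
      have hpos : baseExp N a + 2 * k ≠ 0 := by rw [hbase]; omega
      have hrep := signFourier_replace_pair (odd_baseExp_add N)
        (odd_shiftExp_add N k k a a.rev) (baseExp_injective N) ?_ (Ne.symm h0) ?_ ?_ ?_ ?_ ?_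
      · rw [hsa] at hrep
        have hpos' : (baseExp N a : ℂ) + 2 * k ≠ 0 := by exact_mod_cast hpos
        push_cast at hrep
        field_simp
        linear_combination -hrep
      · intro i j hij
        have hi := i.isLt
        have hj := j.isLt
        simp only [shiftExp, hbase, Fin.ext_iff] at hij ⊢
        split_ifs at hij <;> omega
      · rw [hbase]; omega
      · rw [hsa]; exact hpos
      · rw [hbase, hbase]; omega
      · rw [hsa]
        simp only [shiftExp, if_neg h0, if_true, hbase]
        omega
      · intro j h1 h2
        simp [shiftExp, h1, h2]
  · push Not at hak
    set c : Fin N := ⟨a + k, hak⟩ with hc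
    have hca : c ≠ a := fun h => by have := congrArg Fin.val h; simp [hc] at this; omega
    have hbase : baseExp N c = baseExp N a + 2 * k := by
      simp only [baseExp, hc]; push_cast; ring
    rw [Finset.sum_eq_add a c (Ne.symm hca) ?_ (fun h => absurd (Finset.mem_univ _) h)
      (fun h => absurd (Finset.mem_univ _) h), hdiag]
    -- Raising `a` to the exponent of `c` while lowering `c` to that of `a` merely swaps the two.
    · have h1 : shiftExp N k k a c = fun j => baseExp N (Equiv.swap a c j) := by
        funext j
        unfold shiftExp
        rcases eq_or_ne j a with rfl | hja
        · rw [Equiv.swap_apply_left, hbase, if_pos rfl, if_neg (Ne.symm hca)]; ring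
        rcases eq_or_ne j c with rfl | hjc
        · rw [Equiv.swap_apply_right, hbase, if_pos rfl, if_neg hca]; ring
        · rw [Equiv.swap_apply_of_ne_of_ne hja hjc, if_neg hja, if_neg hjc]; ring
      rw [h1, signFourier_perm, Equiv.Perm.sign_swap (Ne.symm hca)]
      push_cast
      ring
    · intro b _ hb
      refine signFourier_eq_zero_of_not_injective fun hinj => ?_
      refine hca (hinj (a₁ := c) (a₂ := a) ?_)
      simp only [shiftExp, if_neg hca, if_neg (Ne.symm hb.2), if_neg (Ne.symm hb.1), if_true, hbase]
      ring

/-! ### The COE weight as an antisymmetrised exponential. -/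

theorem unitPoint_pow (x : ℝ) (m : ℕ) : unitPoint x ^ m = halfExp (2 * m) x := by
  unfold unitPoint halfExp
  rw [← Complex.exp_nat_mul]
  congr 1
  push_cast
  ring

theorem unitPoint_eq (x : ℝ) : unitPoint x = halfExp 2 x := by
  simpa using unitPoint_pow x 1

theorem norm_unitPoint (x : ℝ) : ‖unitPoint x‖ = 1 := by
  rw [unitPoint_eq, norm_halfExp]

theorem halfExp_neg_mul (m : ℤ) (x : ℝ) : halfExp (-m) x * halfExp m x = 1 := by
  rw [← halfExp_add, neg_add_cancel, halfExp_zero]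

theorem halfExp_pow (m : ℤ) (n : ℕ) (x : ℝ) : halfExp m x ^ n = halfExp (n * m) x := by
  unfold halfExp
  rw [← Complex.exp_nat_mul]
  congr 1
  push_cast
  ring

theorem unitPoint_sub_eq (x y : ℝ) :
    -Complex.I * ((unitPoint y - unitPoint x) * (halfExp (-1) x * halfExp (-1) y))
      = ((2 * Real.sin ((y - x) / 2) : ℝ) : ℂ) := by
  unfold unitPoint halfExp
  push_cast
  rw [Complex.sin, sub_mul, ← Complex.exp_add, ← Complex.exp_add, ← Complex.exp_add]
  rw [show Complex.I * y + (Complex.I * -1 / 2 * x + Complex.I * -1 / 2 * y)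
    = (y - x) / 2 * Complex.I by ring, show Complex.I * x + (Complex.I * -1 / 2 * x
      + Complex.I * -1 / 2 * y) = -((y - x) / 2) * Complex.I by ring]
  ring

/-- The distance is `2 |sin ((y - x)/2)|`, and since `|y - x| < 2π` the sine has the sign of `y -
x`. The absolute value thus becomes an explicit sign times exponentials. -/
theorem norm_unitPoint_sub {x y : ℝ} (hx : x ∈ Set.Ioo 0 (2 * Real.pi))
    (hy : y ∈ Set.Ioo 0 (2 * Real.pi)) :
    ((‖unitPoint x - unitPoint y‖ : ℝ) : ℂ) = -Complex.I * (csign (y - x)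
      * ((unitPoint y - unitPoint x) * (halfExp (-1) x * halfExp (-1) y))) := by
  have h := unitPoint_sub_eq x y
  have hn : ‖unitPoint x - unitPoint y‖ = |2 * Real.sin ((y - x) / 2)| := by
    have := congrArg norm h
    rw [norm_mul, norm_mul, norm_mul, norm_halfExp, norm_halfExp, norm_neg, Complex.norm_I,
      Complex.norm_real, Real.norm_eq_abs, norm_sub_rev] at this
    simpa using this
  rw [mul_left_comm, h, hn]
  obtain ⟨hx0, hx1⟩ := hx
  obtain ⟨hy0, hy1⟩ := hy
  rcases lt_trichotomy x y with hxy | rfl | hxy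
  · rw [csign_of_pos (by linarith), one_mul, abs_of_nonneg]
    exact mul_nonneg zero_le_two (Real.sin_nonneg_of_nonneg_of_le_pi (by linarith) (by linarith))
  · simp
  · rw [csign_of_neg (by linarith), abs_of_nonpos]
    · push_cast; ring
    · have := Real.sin_nonpos_of_nonpos_of_neg_pi_le (x := (y - x) / 2) (by linarith)
        (by linarith)
      linarith

theorem det_vandermonde_unitPoint {N : ℕ} (θ : Fin N → ℝ) :
    (∏ j, halfExp (1 - N) (θ j)) * (Matrix.vandermonde fun j => unitPoint (θ j)).det
      = ∑ σ : Equiv.Perm (Fin N), ((Equiv.Perm.sign σ : ℤ) : ℂ)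
          * ∏ j, halfExp (baseExp N (σ j)) (θ j) := by
  rw [← Matrix.det_transpose, Matrix.det_apply', Finset.mul_sum]
  refine Finset.sum_congr rfl fun σ _ => ?_
  rw [mul_left_comm, ← Finset.prod_mul_distrib]
  congr 1
  refine Finset.prod_congr rfl fun j _ => ?_
  rw [Matrix.transpose_apply, Matrix.vandermonde_apply, unitPoint_pow, ← halfExp_add]
  congr 1
  unfold baseExp
  ring

/-- The phase relating the weight to the Vandermonde determinant. -/
noncomputable def phase (N : ℕ) : ℂ := ∏ j : Fin N, ∏ _k ∈ Finset.Ioi j, -Complex.I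

theorem phase_ne_zero (N : ℕ) : phase N ≠ 0 :=
  Finset.prod_ne_zero_iff.2 fun _ _ => Finset.prod_ne_zero_iff.2 fun _ _ =>
    neg_ne_zero.2 Complex.I_ne_zero

theorem weight_eq {N : ℕ} {θ : Fin N → ℝ} (hθ : ∀ j, θ j ∈ Set.Ioo 0 (2 * Real.pi)) :
    (weight N (1 / 2) θ : ℂ) = phase N * ∑ σ : Equiv.Perm (Fin N),
      ((Equiv.Perm.sign σ : ℤ) : ℂ) * ((∏ j, halfExp (baseExp N (σ j)) (θ j)) * ordSign θ) := by
  have h1 : (weight N (1 / 2) θ : ℂ) = ∏ j, ∏ k ∈ Finset.Ioi j, (-Complex.I * (csign (θ k - θ j)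
      * ((unitPoint (θ k) - unitPoint (θ j)) * (halfExp (-1) (θ j) * halfExp (-1) (θ k))))) := by
    unfold weight
    push_cast
    refine Finset.prod_congr rfl fun j _ => Finset.prod_congr rfl fun k _ => ?_
    rw [← norm_unitPoint_sub (hθ j) (hθ k)]
    norm_num
  have h2 : ∏ j, ∏ k ∈ Finset.Ioi j, (halfExp (-1) (θ j) * halfExp (-1) (θ k))
      = ∏ j, halfExp (1 - N) (θ j) := by
    -- Each index lies in `N - 1` pairs, so the half-angle phases combine to the exponent `1 - N`
    -- that centres the Vandermonde exponents.
    rw [Finset.prod_prod_Ioi_mul_eq_prod_prod_off_diag (fun _ i => halfExp (-1) (θ i))]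
    refine Finset.prod_congr rfl fun j _ => ?_
    rw [Finset.prod_const, Finset.card_compl, Finset.card_singleton, Fintype.card_fin, halfExp_pow]
    congr 1
    have := j.isLt
    omega
  rw [h1]
  simp only [Finset.prod_mul_distrib] at h2 ⊢
  rw [h2, ← Matrix.det_vandermonde (fun j => unitPoint (θ j)), mul_comm (Matrix.det _),
    det_vandermonde_unitPoint]
  change phase N * (ordSign θ * _) = _
  rw [Finset.mul_sum]
  congr 1
  refine Finset.sum_congr rfl fun σ _ => ?_
  ring

theorem integral_prod_halfExp_mul_weight {N : ℕ} (q : Fin N → ℤ) :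
    ∫ θ, (∏ j, halfExp (q j) (θ j)) * (weight N (1 / 2) θ : ℂ) ∂(boxMeasure N)
      = phase N * ∑ σ : Equiv.Perm (Fin N), ((Equiv.Perm.sign σ : ℤ) : ℂ)
          * signFourier (fun j => baseExp N (σ j) + q j) := by
  unfold signFourier
  simp only [← integral_const_mul]
  rw [← integral_finsetSum, ← integral_const_mul]
  · refine integral_congr_ae ?_
    filter_upwards [ae_boxMeasure N] with θ hθ
    rw [weight_eq hθ, mul_left_comm, Finset.mul_sum]
    congr 1
    refine Finset.sum_congr rfl fun σ _ => ?_
    simp only [halfExp_add, Finset.prod_mul_distrib]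
    ring
  · intro σ _
    exact (integrable_prod_halfExp_mul_ordSign _).const_mul _

theorem continuous_weight (N : ℕ) : Continuous fun θ : Fin N → ℝ => weight N (1 / 2) θ := by
  unfold weight unitPoint
  norm_num
  fun_prop

theorem weight_nonneg (N : ℕ) (θ : Fin N → ℝ) : 0 ≤ weight N (1 / 2) θ :=
  Finset.prod_nonneg fun _ _ => Finset.prod_nonneg fun _ _ => Real.rpow_nonneg (norm_nonneg _) _

theorem weight_le (N : ℕ) (θ : Fin N → ℝ) :
    weight N (1 / 2) θ ≤ ∏ j : Fin N, ∏ _k ∈ Finset.Ioi j, (2 : ℝ) := by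
  unfold weight
  refine Finset.prod_le_prod (fun _ _ => Finset.prod_nonneg fun _ _ =>
    Real.rpow_nonneg (norm_nonneg _) _) fun j _ => Finset.prod_le_prod
      (fun _ _ => Real.rpow_nonneg (norm_nonneg _) _) fun k _ => ?_
  norm_num
  refine (norm_sub_le _ _).trans ?_
  rw [norm_unitPoint, norm_unitPoint]
  norm_num

theorem integrable_mul_weight {N : ℕ} {f : (Fin N → ℝ) → ℂ} (hf : Measurable f) {C : ℝ}
    (hC : ∀ θ, ‖f θ‖ ≤ C) :
    Integrable (fun θ => f θ * (weight N (1 / 2) θ : ℂ)) (boxMeasure N) := by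
  refine integrable_boxMeasure_of_bound (hf.mul (Complex.measurable_ofReal.comp
    (continuous_weight N).measurable)) (C := C * ∏ j : Fin N, ∏ _k ∈ Finset.Ioi j, (2 : ℝ))
    fun θ => ?_
  rw [norm_mul, Complex.norm_real, Real.norm_of_nonneg (weight_nonneg N θ)]
  exact mul_le_mul (hC θ) (weight_le N θ) (weight_nonneg N θ) ((norm_nonneg _).trans (hC θ))

/-- Each of the `N!` permutations contributes the same coefficient: its sign appears once from the
determinant and once from `signFourier_perm`. -/
theorem integral_weight (N : ℕ) :
    ∫ θ, (weight N (1 / 2) θ : ℂ) ∂(boxMeasure N)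
      = phase N * (N.factorial * signFourier (baseExp N)) := by
  have h := integral_prod_halfExp_mul_weight (N := N) (fun _ => 0)
  simp only [halfExp_zero, Finset.prod_const_one, one_mul, add_zero] at h
  rw [h]
  congr 1
  rw [← nsmul_eq_mul]
  have : ∀ σ ∈ (Finset.univ : Finset (Equiv.Perm (Fin N))), ((Equiv.Perm.sign σ : ℤ) : ℂ)
      * signFourier (fun j => baseExp N (σ j)) = signFourier (baseExp N) := by
    intro σ _
    rw [signFourier_perm, ← mul_assoc]
    rcases Int.units_eq_one_or (Equiv.Perm.sign σ) with h | h <;> rw [h] <;> simp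
  rw [Finset.sum_congr rfl this, Finset.sum_const, Finset.card_univ, Fintype.card_perm,
    Fintype.card_fin]

theorem integral_weight_ne_zero (N : ℕ) :
    ∫ θ, (weight N (1 / 2) θ : ℂ) ∂(boxMeasure N) ≠ 0 := by
  rw [integral_weight]
  exact mul_ne_zero (phase_ne_zero N) (mul_ne_zero (by exact_mod_cast N.factorial_ne_zero)
    (signFourier_baseExp_ne_zero N))

theorem average_eq (N : ℕ) (f : (Fin N → ℝ) → ℂ) :
    average N (1 / 2) f = (∫ θ, f θ * (weight N (1 / 2) θ : ℂ) ∂(boxMeasure N))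
      / ∫ θ, (weight N (1 / 2) θ : ℂ) ∂(boxMeasure N) := by
  unfold average density partitionFunction
  have h0 : ∫ θ, (weight N (1 / 2) θ : ℂ) ∂(boxMeasure N)
      = ((∫ θ, weight N (1 / 2) θ ∂(boxMeasure N) : ℝ) : ℂ) := integral_ofReal
  rw [angleMeasure_eq, h0]
  push_cast
  have h1 : ∀ θ : Fin N → ℝ, f θ * (((((2 * (Real.pi : ℂ)) ^ N)⁻¹
      * ((∫ θ, weight N (1 / 2) θ ∂(boxMeasure N) : ℝ) : ℂ))⁻¹) * (weight N (1 / 2) θ : ℂ))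
      = ((((2 * (Real.pi : ℂ)) ^ N)⁻¹
      * ((∫ θ, weight N (1 / 2) θ ∂(boxMeasure N) : ℝ) : ℂ))⁻¹)
        * (f θ * (weight N (1 / 2) θ : ℂ)) := fun θ => by ring
  simp only [h1]
  rw [integral_const_mul, mul_inv, inv_inv]
  have h2 : ((2 * (Real.pi : ℂ)) ^ N) ≠ 0 := by simp [Real.pi_ne_zero]
  field_simp

/-! ### Power sums and the form factor. -/

/-- The power sums `∑_j e^{ikθ_j}`. -/
noncomputable def powerSum {N : ℕ} (k : ℤ) (θ : Fin N → ℝ) : ℂ := ∑ j, halfExp (2 * k) (θ j)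

theorem norm_powerSum_le {N : ℕ} (k : ℤ) (θ : Fin N → ℝ) : ‖powerSum k θ‖ ≤ N := by
  unfold powerSum
  refine (norm_sum_le _ _).trans ?_
  simp [norm_halfExp]

theorem measurable_powerSum {N : ℕ} (k : ℤ) : Measurable (powerSum k : (Fin N → ℝ) → ℂ) :=
  Finset.measurable_sum _ fun j _ => (continuous_halfExp _).measurable.comp (measurable_pi_apply j)

@[simp] theorem powerSum_zero {N : ℕ} (θ : Fin N → ℝ) : powerSum 0 θ = N := by
  simp [powerSum]

theorem average_powerSum_mul (N k l : ℕ) :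
    average N (1 / 2) (fun θ => powerSum k θ * powerSum (-l) θ)
      = (∑ a, ∑ b, signFourier (shiftExp N k l a b)) / signFourier (baseExp N) := by
  have h1 : ∀ θ : Fin N → ℝ, powerSum k θ * powerSum (-l) θ = ∑ a, ∑ b, ∏ j,
      halfExp ((if j = a then 2 * (k : ℤ) else 0) + (if j = b then -2 * (l : ℤ) else 0)) (θ j) := by
    intro θ
    unfold powerSum
    rw [Finset.sum_mul_sum]
    refine Finset.sum_congr rfl fun a _ => Finset.sum_congr rfl fun b _ => ?_
    simp only [halfExp_add, Finset.prod_mul_distrib]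
    congr 1
    · rw [Finset.prod_eq_single a] <;> simp +contextual
    · rw [Finset.prod_eq_single b] <;> simp +contextual
  have h2 : ∫ θ, powerSum k θ * powerSum (-l) θ * (weight N (1 / 2) θ : ℂ) ∂(boxMeasure N)
      = phase N * (N.factorial * ∑ a, ∑ b, signFourier (shiftExp N k l a b)) := by
    simp only [h1, Finset.sum_mul]
    have hint : ∀ a b : Fin N, Integrable (fun θ => (∏ j,
        halfExp ((if j = a then 2 * (k : ℤ) else 0) + (if j = b then -2 * (l : ℤ) else 0)) (θ j))
          * (weight N (1 / 2) θ : ℂ)) (boxMeasure N) := fun a b =>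
      integrable_mul_weight (measurable_prod_halfExp _) fun θ => (norm_prod_halfExp _ θ).le
    rw [integral_finsetSum _ fun a _ => integrable_finsetSum _ fun b _ => hint a b]
    simp only [integral_finsetSum _ fun b _ => hint _ b, integral_prod_halfExp_mul_weight]
    simp only [← Finset.mul_sum]
    congr 1
    -- Relabelling `a` and `b` by `σ` turns the exponents into a permutation of `shiftExp`, and the
    -- two signs cancel.
    have h3 : ∀ σ : Equiv.Perm (Fin N), ∑ a, ∑ b, ((Equiv.Perm.sign σ : ℤ) : ℂ) * signFourier
        (fun j => baseExp N (σ j) + ((if j = a then 2 * (k : ℤ) else 0)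
          + (if j = b then -2 * (l : ℤ) else 0)))
        = ∑ a, ∑ b, signFourier (shiftExp N k l a b) := by
      intro σ
      rw [← Equiv.sum_comp σ (fun a => ∑ b, signFourier (shiftExp N k l a b))]
      refine Finset.sum_congr rfl fun a _ => ?_
      rw [← Equiv.sum_comp σ (fun b => signFourier (shiftExp N k l (σ a) b))]
      refine Finset.sum_congr rfl fun b _ => ?_
      have : (fun j => baseExp N (σ j) + ((if j = a then 2 * (k : ℤ) else 0)
          + (if j = b then -2 * (l : ℤ) else 0)))
          = fun j => shiftExp N k l (σ a) (σ b) (σ j) := by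
        funext j
        simp only [shiftExp, σ.injective.eq_iff]
      rw [this, signFourier_perm, ← mul_assoc]
      rcases Int.units_eq_one_or (Equiv.Perm.sign σ) with h | h <;> rw [h] <;> simp
    have h4 : ∑ σ : Equiv.Perm (Fin N), ∑ a, ∑ b, ((Equiv.Perm.sign σ : ℤ) : ℂ) * signFourier
        (fun j => baseExp N (σ j) + ((if j = a then 2 * (k : ℤ) else 0)
          + (if j = b then -2 * (l : ℤ) else 0)))
        = N.factorial * ∑ a, ∑ b, signFourier (shiftExp N k l a b) := by
      rw [Finset.sum_congr rfl fun σ _ => h3 σ, Finset.sum_const, Finset.card_univ,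
        Fintype.card_perm, Fintype.card_fin, nsmul_eq_mul]
    rw [← h4]
    symm
    rw [Finset.sum_comm]
    refine Finset.sum_congr rfl fun a _ => ?_
    rw [Finset.sum_comm]
  rw [average_eq, h2, integral_weight]
  have h5 := phase_ne_zero N
  have h6 : (N.factorial : ℂ) ≠ 0 := by exact_mod_cast N.factorial_ne_zero
  rw [mul_div_mul_left _ _ h5, mul_div_mul_left _ _ h6]

theorem average_powerSum_mul_of_ne (N : ℕ) {k l : ℕ} (hkl : k ≠ l) :
    average N (1 / 2) (fun θ => powerSum k θ * powerSum (-l) θ) = 0 := by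
  rw [average_powerSum_mul]
  simp [signFourier_shiftExp_of_ne hkl]

/-- The form factor of the circular orthogonal ensemble. -/
theorem average_powerSum_mul_self (N : ℕ) {k : ℕ} (hk : 1 ≤ k) :
    average N (1 / 2) (fun θ => powerSum k θ * powerSum (-k) θ)
      = ∑ a : Fin N, if N ≤ a + k then 1 + (baseExp N a : ℂ) / (baseExp N a + 2 * k) else 0 := by
  rw [average_powerSum_mul]
  simp only [sum_signFourier_shiftExp hk]
  rw [← Finset.mul_sum, mul_div_cancel_left₀ _ (signFourier_baseExp_ne_zero N)]

theorem average_const (N : ℕ) (c : ℂ) : average N (1 / 2) (fun _ => c) = c := by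
  rw [average_eq, integral_const_mul, mul_div_cancel_right₀ _ (integral_weight_ne_zero N)]

/-- The weight is bounded and the box has finite measure, so uniform summable bounds justify
exchanging sum and integral. -/
theorem hasSum_average {ι : Type*} [Countable ι] {N : ℕ} {F : ι → (Fin N → ℝ) → ℂ}
    {f : (Fin N → ℝ) → ℂ} {B : ι → ℝ} (hF : ∀ i, Measurable (F i)) (hB : ∀ i θ, ‖F i θ‖ ≤ B i)
    (hsum : Summable B) (hf : ∀ θ, HasSum (fun i => F i θ) (f θ)) :
    HasSum (fun i => average N (1 / 2) (F i)) (average N (1 / 2) f) := by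
  simp only [average_eq]
  refine HasSum.div_const ?_ _
  set K : ℝ := ∏ j : Fin N, ∏ _k ∈ Finset.Ioi j, (2 : ℝ) with hK
  have hbound : ∀ i θ, ‖F i θ * (weight N (1 / 2) θ : ℂ)‖ ≤ B i * K := by
    intro i θ
    rw [norm_mul, Complex.norm_real, Real.norm_of_nonneg (weight_nonneg N θ)]
    exact mul_le_mul (hB i θ) (weight_le N θ) (weight_nonneg N θ) ((norm_nonneg _).trans (hB i θ))
  have h := hasSum_integral_of_summable_integral_norm (μ := boxMeasure N)
    (F := fun i θ => F i θ * (weight N (1 / 2) θ : ℂ))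
    (fun i => integrable_mul_weight (hF i) (hB i)) ?_
  · have he : ∫ θ, (∑' i, F i θ * (weight N (1 / 2) θ : ℂ)) ∂(boxMeasure N)
        = ∫ θ, f θ * (weight N (1 / 2) θ : ℂ) ∂(boxMeasure N) :=
      integral_congr_ae (Filter.Eventually.of_forall fun θ => ((hf θ).mul_right _).tsum_eq)
    rw [he] at h
    exact h
  · refine Summable.of_nonneg_of_le (fun i => integral_nonneg fun _ => norm_nonneg _)
      (fun i => ?_) ((hsum.mul_right K).mul_right ((boxMeasure N).real Set.univ))
    have := integral_mono (μ := boxMeasure N)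
      (integrable_mul_weight (hF i) (hB i)).norm (integrable_const (B i * K)) (hbound i)
    refine this.trans_eq ?_
    rw [integral_const, smul_eq_mul, mul_comm]

theorem average_const_mul (N : ℕ) (c : ℂ) (f : (Fin N → ℝ) → ℂ) :
    average N (1 / 2) (fun θ => c * f θ) = c * average N (1 / 2) f := by
  simp only [average_eq, mul_assoc]
  rw [integral_const_mul, mul_div_assoc]

/-! ### Power series of the resolvent functions. -/

/-- The coefficients of the power series of `(1 + x) / (1 - x)`. -/
def herglotzCoeff (k : ℕ) : ℂ := if k = 0 then 1 else 2

theorem norm_herglotzCoeff_le (k : ℕ) : ‖herglotzCoeff k‖ ≤ 2 := by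
  unfold herglotzCoeff
  split_ifs <;> norm_num

theorem hasSum_herglotzCoeff {x : ℂ} (hx : ‖x‖ < 1) :
    HasSum (fun k => herglotzCoeff k * x ^ k) ((1 + x) / (1 - x)) := by
  have hne : 1 - x ≠ 0 := by
    intro h
    rw [← sub_eq_zero.1 h] at hx
    simp at hx
  have h1 := (hasSum_geometric_of_norm_lt_one hx).mul_left 2
  have h2 : HasSum (fun k : ℕ => if k = 0 then (1 : ℂ) else 0) 1 := hasSum_ite_eq 0 1
  have h3 := h1.sub h2
  have h4 : (2 : ℂ) * (1 - x)⁻¹ - 1 = (1 + x) / (1 - x) := by field_simp; ring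
  rw [h4] at h3
  refine h3.congr_fun ?_
  intro k
  unfold herglotzCoeff
  split_ifs with h
  · subst h; norm_num
  · ring

theorem hasSum_herglotzSum_of_lt {N : ℕ} {z : ℂ} (hz : ‖z‖ < 1) (θ : Fin N → ℝ) :
    HasSum (fun k : ℕ => herglotzCoeff k * z ^ k * powerSum (-k) θ) (herglotzSum N z θ) := by
  unfold herglotzSum powerSum
  simp only [Finset.mul_sum]
  refine hasSum_sum fun j _ => ?_
  have hx : ‖z * halfExp (-2) (θ j)‖ < 1 := by rwa [norm_mul, norm_halfExp, mul_one]
  have h := hasSum_herglotzCoeff hx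
  have hne : unitPoint (θ j) - z ≠ 0 := by
    intro h
    rw [← sub_eq_zero.1 h, norm_unitPoint] at hz
    exact lt_irrefl _ hz
  have hinv : halfExp (-2) (θ j) * unitPoint (θ j) = 1 := by
    rw [unitPoint_eq]; exact halfExp_neg_mul 2 _
  have hne2 : 1 - z * halfExp (-2) (θ j) ≠ 0 := by
    intro h
    rw [← sub_eq_zero.1 h] at hx
    simp at hx
  have he : (1 + z * halfExp (-2) (θ j)) / (1 - z * halfExp (-2) (θ j))
      = (unitPoint (θ j) + z) / (unitPoint (θ j) - z) := by
    rw [div_eq_div_iff hne2 hne]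
    linear_combination (2 * z) * hinv
  rw [he] at h
  refine h.congr_fun ?_
  intro k
  rw [mul_pow, halfExp_pow, mul_assoc]
  congr 3
  ring

theorem hasSum_herglotzSum_of_gt {N : ℕ} {z : ℂ} (hz : 1 < ‖z‖) (θ : Fin N → ℝ) :
    HasSum (fun k : ℕ => -(herglotzCoeff k * (z⁻¹) ^ k * powerSum k θ)) (herglotzSum N z θ) := by
  unfold herglotzSum powerSum
  simp only [Finset.mul_sum, ← Finset.sum_neg_distrib]
  refine hasSum_sum fun j _ => ?_
  have hx : ‖z⁻¹ * unitPoint (θ j)‖ < 1 := by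
    rw [norm_mul, norm_unitPoint, mul_one, norm_inv]
    exact inv_lt_one_of_one_lt₀ hz
  have h := (hasSum_herglotzCoeff hx).neg
  have hz0 : z ≠ 0 := by rintro rfl; norm_num at hz
  have hne : unitPoint (θ j) - z ≠ 0 := by
    intro h
    rw [← sub_eq_zero.1 h, norm_unitPoint] at hz
    exact lt_irrefl _ hz
  have hne2 : 1 - z⁻¹ * unitPoint (θ j) ≠ 0 := by
    intro h
    rw [← sub_eq_zero.1 h] at hx
    simp at hx
  have he : -((1 + z⁻¹ * unitPoint (θ j)) / (1 - z⁻¹ * unitPoint (θ j)))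
      = (unitPoint (θ j) + z) / (unitPoint (θ j) - z) := by
    rw [← neg_div, div_eq_div_iff hne2 hne]
    field_simp
    ring
  rw [he] at h
  refine h.congr_fun ?_
  intro k
  rw [mul_pow, unitPoint_pow, mul_assoc]

/-- This is orthogonality against `powerSum 0`, the nonzero constant `N`. -/
theorem average_powerSum_neg {N : ℕ} (hN : 1 ≤ N) {l : ℕ} (hl : l ≠ 0) :
    average N (1 / 2) (powerSum (-l)) = 0 := by
  have h := average_powerSum_mul_of_ne N (k := 0) (l := l) hl.symm
  simp only [Nat.cast_zero, powerSum_zero, average_const_mul] at h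
  exact (mul_eq_zero.1 h).resolve_left (by exact_mod_cast (by omega : N ≠ 0))

theorem average_powerSum {N : ℕ} (hN : 1 ≤ N) {k : ℕ} (hk : k ≠ 0) :
    average N (1 / 2) (powerSum k) = 0 := by
  have h := average_powerSum_mul_of_ne N (k := k) (l := 0) hk
  simp only [Nat.cast_zero, neg_zero, powerSum_zero, mul_comm _ (N : ℂ), average_const_mul] at h
  exact (mul_eq_zero.1 h).resolve_left (by exact_mod_cast (by omega : N ≠ 0))

theorem W₁_of_lt {N : ℕ} (hN : 1 ≤ N) {z : ℂ} (hz : ‖z‖ < 1) : W₁ N (1 / 2) z = N := by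
  have h := hasSum_average (B := fun k : ℕ => 2 * ‖z‖ ^ k * N)
    (F := fun (k : ℕ) (θ : Fin N → ℝ) => herglotzCoeff k * z ^ k * powerSum (-k) θ)
    (fun k => (measurable_powerSum _).const_mul _) ?_ ?_ (hasSum_herglotzSum_of_lt hz)
  · simp only [average_const_mul] at h
    refine h.unique ?_
    have h2 : HasSum (fun k : ℕ => if k = 0 then (N : ℂ) else 0) N := hasSum_ite_eq 0 _
    refine h2.congr_fun fun k => ?_
    split_ifs with hk
    · subst hk
      simp only [Nat.cast_zero, neg_zero]
      rw [show (powerSum 0 : (Fin N → ℝ) → ℂ) = fun _ => (N : ℂ) from funext powerSum_zero,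
        average_const]
      simp [herglotzCoeff]
    · rw [average_powerSum_neg hN hk, mul_zero]
  · intro k θ
    rw [norm_mul, norm_mul, norm_pow]
    gcongr
    · exact norm_herglotzCoeff_le k
    · exact norm_powerSum_le _ _
  · exact ((summable_geometric_of_lt_one (norm_nonneg _) hz).mul_left 2).mul_right _

theorem W₁_of_gt {N : ℕ} (hN : 1 ≤ N) {z : ℂ} (hz : 1 < ‖z‖) : W₁ N (1 / 2) z = -N := by
  have hz' : ‖z⁻¹‖ < 1 := by rw [norm_inv]; exact inv_lt_one_of_one_lt₀ hz
  have h := hasSum_average (B := fun k : ℕ => 2 * ‖z⁻¹‖ ^ k * N)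
    (F := fun (k : ℕ) (θ : Fin N → ℝ) => -(herglotzCoeff k * (z⁻¹) ^ k * powerSum k θ))
    (fun k => ((measurable_powerSum _).const_mul _).neg) ?_ ?_ (hasSum_herglotzSum_of_gt hz)
  · simp only [← neg_mul, average_const_mul] at h
    refine h.unique ?_
    have h2 : HasSum (fun k : ℕ => if k = 0 then -(N : ℂ) else 0) (-N) := hasSum_ite_eq 0 _
    refine h2.congr_fun fun k => ?_
    split_ifs with hk
    · subst hk
      simp only [Nat.cast_zero]
      rw [show (powerSum 0 : (Fin N → ℝ) → ℂ) = fun _ => (N : ℂ) from funext powerSum_zero,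
        average_const]
      simp [herglotzCoeff]
    · rw [average_powerSum hN hk, mul_zero]
  · intro k θ
    rw [norm_neg, norm_mul, norm_mul, norm_pow]
    gcongr
    · exact norm_herglotzCoeff_le k
    · exact norm_powerSum_le _ _
  · exact ((summable_geometric_of_lt_one (norm_nonneg _) hz').mul_left 2).mul_right _

theorem hasSum_mul_of_summable_norm {f g : ℕ → ℂ} {a b : ℂ} (hf : HasSum f a) (hg : HasSum g b)
    (nf : Summable fun k => ‖f k‖) (ng : Summable fun k => ‖g k‖) :
    HasSum (fun x : ℕ × ℕ => f x.1 * g x.2) (a * b) :=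
  hf.mul hg (summable_mul_of_summable_norm nf ng)

theorem hasSum_U₂ (N : ℕ) {z₁ z₂ : ℂ} (hz₁ : ‖z₁‖ < 1) (hz₂ : 1 < ‖z₂‖) :
    HasSum (fun k : ℕ => -(herglotzCoeff k ^ 2 * (z₁ / z₂) ^ k
      * average N (1 / 2) fun θ => powerSum k θ * powerSum (-k) θ)) (U₂ N (1 / 2) z₁ z₂) := by
  have hz' : ‖z₂⁻¹‖ < 1 := by rw [norm_inv]; exact inv_lt_one_of_one_lt₀ hz₂
  have hs₁ := (summable_geometric_of_lt_one (norm_nonneg _) hz₁)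
  have hs₂ := (summable_geometric_of_lt_one (norm_nonneg _) hz')
  have hpt : ∀ θ : Fin N → ℝ, HasSum (fun kl : ℕ × ℕ =>
      -(herglotzCoeff kl.1 * herglotzCoeff kl.2 * (z₂⁻¹) ^ kl.1 * z₁ ^ kl.2)
        * (powerSum kl.1 θ * powerSum (-kl.2) θ))
      (herglotzSum N z₁ θ * herglotzSum N z₂ θ) := by
    intro θ
    have h1 := hasSum_herglotzSum_of_lt hz₁ θ
    have h2 := hasSum_herglotzSum_of_gt hz₂ θ
    have n1 : Summable fun k : ℕ => ‖herglotzCoeff k * z₁ ^ k * powerSum (-k) θ‖ := by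
      refine Summable.of_nonneg_of_le (fun _ => norm_nonneg _) (fun k => ?_)
        ((hs₁.mul_left 2).mul_right (N : ℝ))
      rw [norm_mul, norm_mul, norm_pow]
      gcongr
      · exact norm_herglotzCoeff_le k
      · exact norm_powerSum_le _ _
    have n2 : Summable fun k : ℕ => ‖-(herglotzCoeff k * (z₂⁻¹) ^ k * powerSum k θ)‖ := by
      refine Summable.of_nonneg_of_le (fun _ => norm_nonneg _) (fun k => ?_)
        ((hs₂.mul_left 2).mul_right (N : ℝ))
      rw [norm_neg, norm_mul, norm_mul, norm_pow]
      gcongr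
      · exact norm_herglotzCoeff_le k
      · exact norm_powerSum_le _ _
    have h3 := hasSum_mul_of_summable_norm h2 h1 n2 n1
    rw [mul_comm (herglotzSum N z₁ θ)]
    refine h3.congr_fun fun kl => ?_
    ring
  have h := hasSum_average (B := fun kl : ℕ × ℕ => (2 * 2 * N * N) * (‖z₂⁻¹‖ ^ kl.1 * ‖z₁‖ ^ kl.2))
    (F := fun (kl : ℕ × ℕ) (θ : Fin N → ℝ) =>
      -(herglotzCoeff kl.1 * herglotzCoeff kl.2 * (z₂⁻¹) ^ kl.1 * z₁ ^ kl.2)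
        * (powerSum kl.1 θ * powerSum (-kl.2) θ))
    (fun kl => ((measurable_powerSum _).mul (measurable_powerSum _)).const_mul _) ?_ ?_ hpt
  · simp only [average_const_mul] at h
    have hinj : Function.Injective (fun k : ℕ => (k, k)) := fun a b hab => congrArg Prod.fst hab
    -- Orthogonality of power sums leaves only the diagonal of the double series.
    rw [← hinj.hasSum_iff] at h
    · refine HasSum.congr_fun h fun k => ?_
      simp only [Function.comp, div_eq_mul_inv, mul_pow]
      ring
    · rintro ⟨k, l⟩ hkl
      have hne : k ≠ l := fun h => hkl ⟨k, by simp [h]⟩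
      simp only
      rw [average_powerSum_mul_of_ne N hne, mul_zero]
  · intro kl θ
    simp only [norm_mul, norm_neg, norm_pow]
    calc ‖herglotzCoeff kl.1‖ * ‖herglotzCoeff kl.2‖ * ‖z₂⁻¹‖ ^ kl.1 * ‖z₁‖ ^ kl.2
          * (‖powerSum (kl.1 : ℤ) θ‖ * ‖powerSum (-(kl.2 : ℤ)) θ‖)
        ≤ 2 * 2 * ‖z₂⁻¹‖ ^ kl.1 * ‖z₁‖ ^ kl.2 * (N * N) := by
          gcongr
          · exact norm_herglotzCoeff_le _
          · exact norm_herglotzCoeff_le _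
          · exact norm_powerSum_le _ _
          · exact norm_powerSum_le _ _
      _ = _ := by ring
  · exact (hs₂.mul_of_nonneg hs₁ (fun _ => by positivity) (fun _ => by positivity)).mul_left _

/-- The product of first resolvents is `-N²`, exactly the `k = 0` term of the series for `U₂`; for
`k ≥ 1` the factor `4` is the square of the Herglotz coefficient. -/
theorem hasSum_coeW₂ {N : ℕ} (hN : 1 ≤ N) {z₁ z₂ : ℂ} (hz₁ : ‖z₁‖ < 1) (hz₂ : 1 < ‖z₂‖) :
    HasSum (fun k : ℕ => ∑ a : Fin N, if N ≤ a + k then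
      -4 * ((z₁ / z₂) ^ k * (1 + (baseExp N a : ℂ) / (baseExp N a + 2 * k))) else 0)
      (coeW₂ N z₁ z₂) := by
  have h0 : HasSum (fun k : ℕ => if k = 0 then (N : ℂ) * N else 0) ((N : ℂ) * N) :=
    hasSum_ite_eq 0 _
  have h := (hasSum_U₂ N hz₁ hz₂).add h0
  have hW : U₂ N (1 / 2) z₁ z₂ + (N : ℂ) * N = coeW₂ N z₁ z₂ := by
    unfold coeW₂ W₂
    rw [W₁_of_lt hN hz₁, W₁_of_gt hN hz₂]
    ring
  rw [hW] at h
  refine h.congr_fun fun k => ?_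
  rcases Nat.eq_zero_or_pos k with rfl | hk
  · simp only [Nat.cast_zero, neg_zero, powerSum_zero, average_const]
    rw [Finset.sum_eq_zero]
    · simp [herglotzCoeff]
    · intro a _
      rw [if_neg]
      have := a.isLt
      omega
  · rw [average_powerSum_mul_self N hk, if_neg hk.ne', Finset.mul_sum, ← Finset.sum_neg_distrib,
      add_zero]
    refine Finset.sum_congr rfl fun a _ => ?_
    split_ifs
    · simp only [herglotzCoeff, if_neg hk.ne']
      ring
    · simp

/-! ### The closed form. -/

/-- The power series `∑_n ζ^n / (N + 1 + 2n)`. -/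
noncomputable def lerchSum (N : ℕ) (ζ : ℂ) : ℂ := ∑' n : ℕ, ζ ^ n / ((N : ℂ) + 1 + 2 * n)

theorem add_one_add_two_mul_ne_zero (N n : ℕ) : (N : ℂ) + 1 + 2 * n ≠ 0 := by
  exact_mod_cast (by omega : N + 1 + 2 * n ≠ 0)

theorem hasSum_lerchSum (N : ℕ) {ζ : ℂ} (hζ : ‖ζ‖ < 1) :
    HasSum (fun n : ℕ => ζ ^ n / ((N : ℂ) + 1 + 2 * n)) (lerchSum N ζ) := by
  refine Summable.hasSum (Summable.of_norm_bounded
    (summable_geometric_of_lt_one (norm_nonneg ζ) hζ) fun n => ?_)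
  rw [norm_div, norm_pow]
  refine div_le_self (by positivity) ?_
  rw [show (N : ℂ) + 1 + 2 * n = ((N + 1 + 2 * n : ℕ) : ℂ) by push_cast; ring, Complex.norm_natCast]
  exact_mod_cast (by omega : 1 ≤ N + 1 + 2 * n)

/-- With `i = N - 1 - a` and `k = n + i + 1`, the denominator `baseExp N a + 2k` becomes `N + 1 +
2n`. It is independent of `i`, so the sum over `n` gives the same series for every particle index.
-/
theorem coeW₂_eq_sum {N : ℕ} (hN : 1 ≤ N) {z₁ z₂ : ℂ} (hz₁ : ‖z₁‖ < 1) (hz₂ : 1 < ‖z₂‖) :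
    coeW₂ N z₁ z₂ = ∑ i ∈ Finset.range N, -4 * ((z₁ / z₂) ^ (i + 1)
      * ((1 - z₁ / z₂)⁻¹ + ((N : ℂ) - 1 - 2 * i) * lerchSum N (z₁ / z₂))) := by
  have hζ : ‖z₁ / z₂‖ < 1 := by
    rw [norm_div, div_lt_one (by linarith)]; linarith
  have h := hasSum_coeW₂ hN hz₁ hz₂
  set ζ := z₁ / z₂
  refine h.unique ?_
  rw [Finset.sum_range, ← Equiv.sum_comp Fin.revPerm]
  refine hasSum_sum fun a _ => ?_
  set i : ℕ := ((Fin.revPerm a : Fin N) : ℕ) with hi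
  have hia : i = N - (a + 1) := by rw [hi]; exact Fin.val_rev a
  have ha := a.isLt
  have hbase : (baseExp N a : ℂ) = N - 1 - 2 * i := by
    have : baseExp N a = N - 1 - 2 * i := by unfold baseExp; omega
    rw [this]; push_cast; ring
  have hinj : Function.Injective fun n : ℕ => n + (i + 1) := add_left_injective _
  rw [← hinj.hasSum_iff]
  · have h1 := (((hasSum_geometric_of_norm_lt_one hζ).add
      ((hasSum_lerchSum N hζ).mul_left ((N : ℂ) - 1 - 2 * i))).mul_left (ζ ^ (i + 1))).mul_left (-4)
    refine h1.congr_fun fun n => ?_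
    simp only [Function.comp]
    rw [if_pos (by omega), hbase, pow_add]
    have hne := add_one_add_two_mul_ne_zero N n
    have he : (N : ℂ) - 1 - 2 * i + 2 * ((n + (i + 1) : ℕ) : ℂ) = N + 1 + 2 * n := by
      push_cast; ring
    rw [he]
    ring
  · intro k hk
    rw [if_neg]
    intro hle
    exact hk ⟨k - (i + 1), by simp only; omega⟩

theorem coeW₂_eq_lerchSum {N : ℕ} (hN : 1 ≤ N) {z₁ z₂ : ℂ} (hz₁ : ‖z₁‖ < 1) (hz₂ : 1 < ‖z₂‖)
    {ζ : ℂ} (hζ : ζ = z₁ / z₂) :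
    coeW₂ N z₁ z₂ = -4 * ζ * (1 - ζ ^ N) / (1 - ζ) ^ 2
      + 4 * (2 * ζ ^ 2 * (1 - ζ ^ N) / (1 - ζ) ^ 2
        - ζ * ((N : ℂ) - 1 + (N + 1) * ζ ^ N) / (1 - ζ)) * lerchSum N ζ := by
  have hζ1 : ‖ζ‖ < 1 := by
    rw [hζ, norm_div, div_lt_one (by linarith)]; linarith
  have hne : 1 - ζ ≠ 0 := by
    intro h
    rw [← sub_eq_zero.1 h] at hζ1
    simp at hζ1
  rw [coeW₂_eq_sum hN hz₁ hz₂, ← hζ]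
  -- The constant `c`, later `N - 1`, is kept apart from the number of terms `M` so that it stays
  -- fixed in the induction.
  have key : ∀ (M : ℕ) (c A B : ℂ), ∑ i ∈ Finset.range M, -4 * (ζ ^ (i + 1)
      * (A + (c - 2 * i) * B))
      = -4 * ((A + c * B) * (ζ * (1 - ζ ^ M) / (1 - ζ))
        - 2 * B * (ζ * (ζ - M * ζ ^ M + (M - 1) * ζ ^ (M + 1)) / (1 - ζ) ^ 2)) := by
    intro M c A B
    induction M with
    | zero => simp
    | succ M ih =>
      rw [Finset.sum_range_succ, ih]
      field_simp
      push_cast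
      ring
  rw [key]
  field_simp
  ring

/-- With `b = (N + 1)/2`, the Pochhammer ratio `(b)_n/(b + 1)_n` telescopes to `b/(b + n)` and
`(1)_n` cancels `n!`. The series agree term by term. -/
theorem ordinaryHypergeometric_eq_lerchSum (N : ℕ) (ζ : ℂ) :
    ordinaryHypergeometric (1 : ℂ) (((N : ℂ) + 1) / 2) (((N : ℂ) + 3) / 2) ζ
      = ((N : ℂ) + 1) * lerchSum N ζ := by
  rw [ordinaryHypergeometric_eq_tsum, lerchSum, ← tsum_mul_left]
  refine tsum_congr fun n => ?_
  set b : ℂ := ((N : ℂ) + 1) / 2 with hb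
  have hc : ((N : ℂ) + 3) / 2 = b + 1 := by rw [hb]; ring
  have hfac : ((n.factorial : ℕ) : ℂ) ≠ 0 := by exact_mod_cast n.factorial_ne_zero
  have hne := add_one_add_two_mul_ne_zero N n
  have h1 : b * (ascPochhammer ℂ n).eval (b + 1) = (ascPochhammer ℂ n).eval b * (b + n) := by
    rw [← ascPochhammer_succ_eval, ascPochhammer_succ_left]
    simp
  have h2 : (ascPochhammer ℂ n).eval (b + 1) ≠ 0 := by
    rw [Ne, ascPochhammer_eval_eq_zero_iff]
    rintro ⟨k, _, hk⟩
    refine add_one_add_two_mul_ne_zero N (k + 1) ?_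
    rw [hb] at hk
    push_cast
    linear_combination 2 * hk
  rw [hc, ascPochhammer_eval_one, inv_mul_cancel₀ hfac, one_mul, smul_eq_mul]
  have hb2 : b + n ≠ 0 := by
    intro h
    rw [hb] at h
    exact hne (by linear_combination 2 * h)
  have h3 : (ascPochhammer ℂ n).eval b = b * (ascPochhammer ℂ n).eval (b + 1) / (b + n) := by
    rw [h1, mul_div_cancel_right₀ _ hb2]
  have h4 : (N : ℂ) + 1 = 2 * b := by rw [hb]; ring
  rw [h3, h4, show 2 * b + 2 * (n : ℂ) = 2 * (b + n) by ring]
  field_simp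

theorem coeW₂_eq_coeExact {N : ℕ} (hN : 1 ≤ N) {z₁ z₂ : ℂ} (hz₁ : ‖z₁‖ < 1) (hz₂ : 1 < ‖z₂‖) :
    coeW₂ N z₁ z₂ = coeExact N (z₁ / z₂) := by
  have hζ1 : ‖z₁ / z₂‖ < 1 := by
    rw [norm_div, div_lt_one (by linarith)]; linarith
  rw [coeW₂_eq_lerchSum hN hz₁ hz₂ rfl]
  set ζ := z₁ / z₂
  have hne : 1 - ζ ≠ 0 := by
    intro h
    rw [← sub_eq_zero.1 h] at hζ1
    simp at hζ1
  have hN1 : (N : ℂ) + 1 ≠ 0 := by exact_mod_cast N.succ_ne_zero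
  unfold coeExact
  rw [ordinaryHypergeometric_eq_lerchSum]
  field_simp
  ring

/-! ### Generating functions of powers of odd numbers. -/

/-- The power series `∑_n (2n + 1)^j ζ^n`. -/
noncomputable def oddPowSum (j : ℕ) (ζ : ℂ) : ℂ := ∑' n : ℕ, (2 * (n : ℂ) + 1) ^ j * ζ ^ n

theorem summable_oddPow_mul {ρ : ℝ} (hρ : 0 ≤ ρ) (hρ1 : ρ < 1) (j : ℕ) :
    Summable fun n : ℕ => (2 * (n : ℝ) + 1) ^ j * ρ ^ n := by
  have hn : ‖ρ‖ < 1 := by rwa [Real.norm_of_nonneg hρ]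
  have h : ∀ n : ℕ, (2 * (n : ℝ) + 1) ^ j * ρ ^ n
      = ∑ i ∈ Finset.range (j + 1), 2 ^ i * (j.choose i : ℝ) * ((n : ℝ) ^ i * ρ ^ n) := by
    intro n
    rw [add_pow, Finset.sum_mul]
    refine Finset.sum_congr rfl fun i _ => ?_
    rw [mul_pow]
    ring
  simp only [h]
  exact summable_sum fun i _ => (summable_pow_mul_geometric_of_norm_lt_one i hn).mul_left _

theorem norm_oddPow_mul (j n : ℕ) (ζ : ℂ) :
    ‖(2 * (n : ℂ) + 1) ^ j * ζ ^ n‖ = (2 * (n : ℝ) + 1) ^ j * ‖ζ‖ ^ n := by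
  rw [norm_mul, norm_pow, norm_pow, show 2 * (n : ℂ) + 1 = ((2 * n + 1 : ℕ) : ℂ) by push_cast; ring,
    Complex.norm_natCast]
  push_cast
  ring

theorem hasSum_oddPowSum {ζ : ℂ} (hζ : ‖ζ‖ < 1) (j : ℕ) :
    HasSum (fun n : ℕ => (2 * (n : ℂ) + 1) ^ j * ζ ^ n) (oddPowSum j ζ) := by
  refine Summable.hasSum (Summable.of_norm ?_)
  simp only [norm_oddPow_mul]
  exact summable_oddPow_mul (norm_nonneg _) hζ j

theorem norm_oddPowSum_le {ζ : ℂ} {ρ : ℝ} (hζ : ‖ζ‖ ≤ ρ) (hρ1 : ρ < 1) (j : ℕ) :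
    ‖oddPowSum j ζ‖ ≤ ∑' n : ℕ, (2 * (n : ℝ) + 1) ^ j * ρ ^ n := by
  have hρ : 0 ≤ ρ := (norm_nonneg _).trans hζ
  refine tsum_of_norm_bounded (summable_oddPow_mul hρ hρ1 j).hasSum fun n => ?_
  rw [norm_oddPow_mul]
  gcongr

/-- Split off `n = 0`, write `2(n + 1) + 1 = (2n + 1) + 2` and use the binomial theorem. Moving the
`i = j` term to the left gives `(1 - ζ) * oddPowSum j ζ` in terms of lower sums, hence the closed
forms below, whose numerators are the Eulerian polynomials of type B. -/
theorem oddPowSum_recursion {ζ : ℂ} (hζ : ‖ζ‖ < 1) (j : ℕ) :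
    oddPowSum j ζ = 1 + ζ * ∑ i ∈ Finset.range (j + 1),
      oddPowSum i ζ * 2 ^ (j - i) * (j.choose i : ℂ) := by
  have h := (hasSum_nat_add_iff' 1).2 (hasSum_oddPowSum hζ j)
  have h2 : HasSum (fun n : ℕ => (2 * ((n + 1 : ℕ) : ℂ) + 1) ^ j * ζ ^ (n + 1))
      (ζ * ∑ i ∈ Finset.range (j + 1), oddPowSum i ζ * 2 ^ (j - i) * (j.choose i : ℂ)) := by
    have h3 := (hasSum_sum (s := Finset.range (j + 1)) fun i _ =>
      (((hasSum_oddPowSum hζ i).mul_right (2 ^ (j - i))).mul_right (j.choose i : ℂ))).mul_left ζ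
    refine h3.congr_fun fun n => ?_
    rw [show 2 * ((n + 1 : ℕ) : ℂ) + 1 = (2 * n + 1) + 2 by push_cast; ring, add_pow,
      Finset.sum_mul, Finset.mul_sum]
    refine Finset.sum_congr rfl fun i _ => ?_
    ring
  have h4 := h.unique h2
  simp only [Finset.range_one, Finset.sum_singleton, Nat.cast_zero, mul_zero, zero_add, one_pow,
    pow_zero, mul_one] at h4
  linear_combination h4

theorem one_sub_ne_zero_of_norm_lt_one {ζ : ℂ} (hζ : ‖ζ‖ < 1) : 1 - ζ ≠ 0 := by
  intro h
  rw [← sub_eq_zero.1 h] at hζ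
  simp at hζ

theorem oddPowSum_zero {ζ : ℂ} (hζ : ‖ζ‖ < 1) : oddPowSum 0 ζ = 1 / (1 - ζ) ^ 1 := by
  have h := hasSum_oddPowSum hζ 0
  simp only [pow_zero, one_mul] at h
  rw [h.unique (hasSum_geometric_of_norm_lt_one hζ), pow_one, one_div]

theorem oddPowSum_one {ζ : ℂ} (hζ : ‖ζ‖ < 1) :
    oddPowSum 1 ζ = (1 + ζ)
      / (1 - ζ) ^ 2 := by
  have hne := one_sub_ne_zero_of_norm_lt_one hζ
  have h := oddPowSum_recursion hζ 1
  simp only [Finset.sum_range_succ, Finset.sum_range_zero, Nat.choose, Nat.reduceAdd, Nat.reduceSub,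
    Nat.cast_one, zero_add, pow_zero, mul_one,
    oddPowSum_zero hζ] at h
  refine mul_left_cancel₀ hne ?_
  rw [sub_mul, one_mul, sub_eq_iff_eq_add]
  refine h.trans ?_
  field_simp
  ring

theorem oddPowSum_two {ζ : ℂ} (hζ : ‖ζ‖ < 1) :
    oddPowSum 2 ζ = (1 + 6 * ζ + ζ ^ 2)
      / (1 - ζ) ^ 3 := by
  have hne := one_sub_ne_zero_of_norm_lt_one hζ
  have h := oddPowSum_recursion hζ 2
  simp only [Finset.sum_range_succ, Finset.sum_range_zero, Nat.choose, Nat.reduceAdd, Nat.reduceSub,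
    Nat.cast_ofNat, Nat.cast_one, zero_add, pow_zero, mul_one,
    oddPowSum_zero hζ, oddPowSum_one hζ] at h
  refine mul_left_cancel₀ hne ?_
  rw [sub_mul, one_mul, sub_eq_iff_eq_add]
  refine h.trans ?_
  field_simp
  ring

theorem oddPowSum_three {ζ : ℂ} (hζ : ‖ζ‖ < 1) :
    oddPowSum 3 ζ = (1 + 23 * ζ + 23 * ζ ^ 2 + ζ ^ 3)
      / (1 - ζ) ^ 4 := by
  have hne := one_sub_ne_zero_of_norm_lt_one hζ
  have h := oddPowSum_recursion hζ 3
  simp only [Finset.sum_range_succ, Finset.sum_range_zero, Nat.choose, Nat.reduceAdd, Nat.reduceSub,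
    Nat.cast_ofNat, Nat.cast_one, zero_add, pow_zero, mul_one,
    oddPowSum_zero hζ, oddPowSum_one hζ, oddPowSum_two hζ] at h
  refine mul_left_cancel₀ hne ?_
  rw [sub_mul, one_mul, sub_eq_iff_eq_add]
  refine h.trans ?_
  field_simp
  ring

theorem oddPowSum_four {ζ : ℂ} (hζ : ‖ζ‖ < 1) :
    oddPowSum 4 ζ = (1 + 76 * ζ + 230 * ζ ^ 2 + 76 * ζ ^ 3 + ζ ^ 4)
      / (1 - ζ) ^ 5 := by
  have hne := one_sub_ne_zero_of_norm_lt_one hζ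
  have h := oddPowSum_recursion hζ 4
  simp only [Finset.sum_range_succ, Finset.sum_range_zero, Nat.choose, Nat.reduceAdd, Nat.reduceSub,
    Nat.cast_ofNat, Nat.cast_one, zero_add, pow_zero, mul_one,
    oddPowSum_zero hζ, oddPowSum_one hζ, oddPowSum_two hζ, oddPowSum_three hζ] at h
  refine mul_left_cancel₀ hne ?_
  rw [sub_mul, one_mul, sub_eq_iff_eq_add]
  refine h.trans ?_
  field_simp
  ring

theorem oddPowSum_five {ζ : ℂ} (hζ : ‖ζ‖ < 1) :
    oddPowSum 5 ζ = (1 + 237 * ζ + 1682 * ζ ^ 2 + 1682 * ζ ^ 3 + 237 * ζ ^ 4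
      + ζ ^ 5)
      / (1 - ζ) ^ 6 := by
  have hne := one_sub_ne_zero_of_norm_lt_one hζ
  have h := oddPowSum_recursion hζ 5
  simp only [Finset.sum_range_succ, Finset.sum_range_zero, Nat.choose, Nat.reduceAdd, Nat.reduceSub,
    Nat.cast_ofNat, Nat.cast_one, zero_add, pow_zero, mul_one,
    oddPowSum_zero hζ, oddPowSum_one hζ, oddPowSum_two hζ, oddPowSum_three hζ,
    oddPowSum_four hζ] at h
  refine mul_left_cancel₀ hne ?_
  rw [sub_mul, one_mul, sub_eq_iff_eq_add]
  refine h.trans ?_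
  field_simp
  ring

theorem oddPowSum_six {ζ : ℂ} (hζ : ‖ζ‖ < 1) :
    oddPowSum 6 ζ = (1 + 722 * ζ + 10543 * ζ ^ 2 + 23548 * ζ ^ 3 + 10543 * ζ ^ 4
      + 722 * ζ ^ 5 + ζ ^ 6)
      / (1 - ζ) ^ 7 := by
  have hne := one_sub_ne_zero_of_norm_lt_one hζ
  have h := oddPowSum_recursion hζ 6
  simp only [Finset.sum_range_succ, Finset.sum_range_zero, Nat.choose, Nat.reduceAdd, Nat.reduceSub,
    Nat.cast_ofNat, Nat.cast_one, zero_add, pow_zero, mul_one,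
    oddPowSum_zero hζ, oddPowSum_one hζ, oddPowSum_two hζ, oddPowSum_three hζ,
    oddPowSum_four hζ, oddPowSum_five hζ] at h
  refine mul_left_cancel₀ hne ?_
  rw [sub_mul, one_mul, sub_eq_iff_eq_add]
  refine h.trans ?_
  field_simp
  ring

theorem oddPowSum_seven {ζ : ℂ} (hζ : ‖ζ‖ < 1) :
    oddPowSum 7 ζ = (1 + 2179 * ζ + 60657 * ζ ^ 2 + 259723 * ζ ^ 3 + 259723 * ζ ^ 4
      + 60657 * ζ ^ 5 + 2179 * ζ ^ 6 + ζ ^ 7)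
      / (1 - ζ) ^ 8 := by
  have hne := one_sub_ne_zero_of_norm_lt_one hζ
  have h := oddPowSum_recursion hζ 7
  simp only [Finset.sum_range_succ, Finset.sum_range_zero, Nat.choose, Nat.reduceAdd, Nat.reduceSub,
    Nat.cast_ofNat, Nat.cast_one, zero_add, pow_zero, mul_one,
    oddPowSum_zero hζ, oddPowSum_one hζ, oddPowSum_two hζ, oddPowSum_three hζ,
    oddPowSum_four hζ, oddPowSum_five hζ, oddPowSum_six hζ] at h
  refine mul_left_cancel₀ hne ?_
  rw [sub_mul, one_mul, sub_eq_iff_eq_add]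
  refine h.trans ?_
  field_simp
  ring

theorem oddPowSum_eight {ζ : ℂ} (hζ : ‖ζ‖ < 1) :
    oddPowSum 8 ζ = (1 + 6552 * ζ + 331612 * ζ ^ 2 + 2485288 * ζ ^ 3
      + 4675014 * ζ ^ 4 + 2485288 * ζ ^ 5 + 331612 * ζ ^ 6 + 6552 * ζ ^ 7 + ζ ^ 8)
      / (1 - ζ) ^ 9 := by
  have hne := one_sub_ne_zero_of_norm_lt_one hζ
  have h := oddPowSum_recursion hζ 8
  simp only [Finset.sum_range_succ, Finset.sum_range_zero, Nat.choose, Nat.reduceAdd, Nat.reduceSub,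
    Nat.cast_ofNat, Nat.cast_one, zero_add, pow_zero, mul_one,
    oddPowSum_zero hζ, oddPowSum_one hζ, oddPowSum_two hζ, oddPowSum_three hζ,
    oddPowSum_four hζ, oddPowSum_five hζ, oddPowSum_six hζ, oddPowSum_seven hζ] at h
  refine mul_left_cancel₀ hne ?_
  rw [sub_mul, one_mul, sub_eq_iff_eq_add]
  refine h.trans ?_
  field_simp
  ring

theorem oddPowSum_nine {ζ : ℂ} (hζ : ‖ζ‖ < 1) :
    oddPowSum 9 ζ = (1 + 19673 * ζ + 1756340 * ζ ^ 2 + 21707972 * ζ ^ 3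
      + 69413294 * ζ ^ 4 + 69413294 * ζ ^ 5 + 21707972 * ζ ^ 6 + 1756340 * ζ ^ 7
      + 19673 * ζ ^ 8 + ζ ^ 9)
      / (1 - ζ) ^ 10 := by
  have hne := one_sub_ne_zero_of_norm_lt_one hζ
  have h := oddPowSum_recursion hζ 9
  simp only [Finset.sum_range_succ, Finset.sum_range_zero, Nat.choose, Nat.reduceAdd, Nat.reduceSub,
    Nat.cast_ofNat, Nat.cast_one, zero_add, pow_zero, mul_one,
    oddPowSum_zero hζ, oddPowSum_one hζ, oddPowSum_two hζ, oddPowSum_three hζ,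
    oddPowSum_four hζ, oddPowSum_five hζ, oddPowSum_six hζ, oddPowSum_seven hζ,
    oddPowSum_eight hζ] at h
  refine mul_left_cancel₀ hne ?_
  rw [sub_mul, one_mul, sub_eq_iff_eq_add]
  refine h.trans ?_
  field_simp
  ring

/-! ### The large-`N` expansion and its error. -/

/-- The large `N` expansion of `lerchSum N ζ`, truncated after `J` terms. -/
noncomputable def lerchTrunc (J N : ℕ) (ζ : ℂ) : ℂ :=
  ∑ j ∈ Finset.range J, (-1) ^ j / (N : ℂ) ^ (j + 1) * oddPowSum j ζ

theorem norm_lerchSum_sub_lerchTrunc_le (J : ℕ) {N : ℕ} (hN : 1 ≤ N) {ζ : ℂ} {ρ : ℝ}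
    (hζ : ‖ζ‖ ≤ ρ) (hρ1 : ρ < 1) :
    ‖lerchSum N ζ - lerchTrunc J N ζ‖
      ≤ (∑' n : ℕ, (2 * (n : ℝ) + 1) ^ J * ρ ^ n) / (N : ℝ) ^ (J + 1) := by
  have hρ : 0 ≤ ρ := (norm_nonneg _).trans hζ
  have hζ1 : ‖ζ‖ < 1 := hζ.trans_lt hρ1
  have hN0 : (N : ℂ) ≠ 0 := by exact_mod_cast (by omega : N ≠ 0)
  have h := (hasSum_lerchSum N hζ1).sub (hasSum_sum (s := Finset.range J) fun j _ =>
    (hasSum_oddPowSum hζ1 j).mul_left ((-1) ^ j / (N : ℂ) ^ (j + 1)))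
  have h' := h.tsum_eq
  change _ = lerchSum N ζ - lerchTrunc J N ζ at h'
  rw [← h']
  refine tsum_of_norm_bounded ((summable_oddPow_mul hρ hρ1 J).hasSum.div_const _) fun n => ?_
  have hne := add_one_add_two_mul_ne_zero N n
  -- This is the exact remainder of the finite geometric expansion of `1/(N + (2n + 1))` in powers
  -- of `-(2n + 1)/N`.
  have hid : ∀ J : ℕ, ζ ^ n / ((N : ℂ) + 1 + 2 * n) - ∑ j ∈ Finset.range J,
      (-1) ^ j / (N : ℂ) ^ (j + 1) * ((2 * (n : ℂ) + 1) ^ j * ζ ^ n)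
      = (-1) ^ J * ((2 * (n : ℂ) + 1) ^ J * ζ ^ n) / (N : ℂ) ^ J / ((N : ℂ) + 1 + 2 * n) := by
    intro J
    induction J with
    | zero => simp
    | succ J ih =>
      rw [Finset.sum_range_succ, ← sub_sub, ih]
      field_simp
      ring
  rw [hid, norm_div, norm_div, norm_mul, norm_oddPow_mul, norm_pow, norm_pow, norm_neg, norm_one,
    one_pow, one_mul, Complex.norm_natCast,
    show (N : ℂ) + 1 + 2 * n = ((N + 1 + 2 * n : ℕ) : ℂ) by push_cast; ring, Complex.norm_natCast,
    div_div, pow_succ]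
  have hNpos : (0 : ℝ) < N := by exact_mod_cast hN
  gcongr
  omega

/-- The left side is the closed form with all `ζ^N` terms dropped and the series truncated. The
prefactor contains both `N` and `1`, so consecutive odd power sums combine at each order; the last
one is left over at order `N^{-10}`. -/
theorem expansion_eq {N : ℕ} (hN : 1 ≤ N) {ζ : ℂ} (hζ : ‖ζ‖ < 1) :
    -4 * ζ / (1 - ζ) ^ 2 + 4 * (ζ * (1 + ζ) / (1 - ζ) ^ 2 - ζ * N / (1 - ζ)) * lerchTrunc 10 N ζ
      = coeGlobalExpansion N ζ
        - 4 * (ζ * (1 + ζ) / (1 - ζ) ^ 2) * oddPowSum 9 ζ / (N : ℂ) ^ 10 := by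
  have hN0 : (N : ℂ) ≠ 0 := by exact_mod_cast (by omega : N ≠ 0)
  have hne := one_sub_ne_zero_of_norm_lt_one hζ
  unfold lerchTrunc coeGlobalExpansion
  simp only [Finset.sum_range_succ, Finset.sum_range_zero, oddPowSum_zero hζ, oddPowSum_one hζ,
    oddPowSum_two hζ, oddPowSum_three hζ, oddPowSum_four hζ, oddPowSum_five hζ, oddPowSum_six hζ,
    oddPowSum_seven hζ, oddPowSum_eight hζ, oddPowSum_nine hζ]
  -- In the variable `w = 1 - ζ` all denominators are monomials, so clearing them leaves a
  -- polynomial identity.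
  obtain ⟨w, hw⟩ : ∃ w, w = 1 - ζ := ⟨_, rfl⟩
  have hζw : ζ = 1 - w := by rw [hw]; ring
  rw [← hw] at hne ⊢
  rw [show ζ - 1 = -w by rw [hw]; ring]
  field_simp
  rw [hζw]
  ring

theorem exists_pow_mul_pow_le {ρ : ℝ} (hρ : 0 ≤ ρ) (hρ1 : ρ < 1) (k : ℕ) :
    ∃ M : ℝ, ∀ n : ℕ, (n : ℝ) ^ k * ρ ^ n ≤ M := by
  have h := summable_pow_mul_geometric_of_norm_lt_one k
    (show ‖ρ‖ < 1 by rwa [Real.norm_of_nonneg hρ])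
  exact ⟨_, fun n => h.le_tsum n fun _ _ => by positivity⟩

theorem norm_lerchSum_le {N : ℕ} {ζ : ℂ} {ρ : ℝ} (hζ : ‖ζ‖ ≤ ρ) (hρ1 : ρ < 1) :
    ‖lerchSum N ζ‖ ≤ (1 - ρ)⁻¹ := by
  have hρ : 0 ≤ ρ := (norm_nonneg _).trans hζ
  refine tsum_of_norm_bounded (hasSum_geometric_of_lt_one hρ hρ1) fun n => ?_
  rw [norm_div, norm_pow, show (N : ℂ) + 1 + 2 * n = ((N + 1 + 2 * n : ℕ) : ℂ) by push_cast; ring,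
    Complex.norm_natCast]
  refine (div_le_self (by positivity) ?_).trans (by gcongr)
  exact_mod_cast (by omega : 1 ≤ N + 1 + 2 * n)

theorem exists_bound_coeW₂_sub {δ : ℝ} (hδ : 0 < δ) (hδ1 : δ < 1) :
    ∃ C : ℝ, ∀ N : ℕ, 1 ≤ N → ∀ z₁ z₂ : ℂ, ‖z₁‖ < 1 - δ → 1 + δ < ‖z₂‖ →
      ‖coeW₂ N z₁ z₂ - coeGlobalExpansion N (z₁ / z₂)‖ ≤ C / (N : ℝ) ^ 10 := by
  set ρ : ℝ := (1 - δ) / (1 + δ) with hρdef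
  have hρ : 0 ≤ ρ := div_nonneg (by linarith) (by linarith)
  have hρ1 : ρ < 1 := by rw [hρdef, div_lt_one (by linarith)]; linarith
  -- The exponent is `11` because the factor multiplying `ζ^N` grows like `N` and `N^{-10}` is to be
  -- gained.
  obtain ⟨M, hM⟩ := exists_pow_mul_pow_le hρ hρ1 11
  set D : ℝ := (1 - ρ)⁻¹ with hD
  have hDpos : 0 < D := inv_pos.2 (by linarith)
  set K₉ : ℝ := ∑' n : ℕ, (2 * (n : ℝ) + 1) ^ 9 * ρ ^ n with hK9
  set K₁₀ : ℝ := ∑' n : ℕ, (2 * (n : ℝ) + 1) ^ 10 * ρ ^ n with hK10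
  -- The three summands bound the leftover term of `expansion_eq`, the truncation error and the
  -- `ζ^N` terms, as in `hsplit`.
  refine ⟨4 * (2 * D ^ 2) * K₉ + 4 * (2 * D ^ 2 + D) * K₁₀
    + M * (4 * D ^ 2 + 4 * (2 * D ^ 2 + 2 * D) * D), fun N hN z₁ z₂ hz₁ hz₂ => ?_⟩
  have hζρ : ‖z₁ / z₂‖ ≤ ρ := by
    rw [norm_div, hρdef]
    gcongr
  rw [coeW₂_eq_lerchSum hN (by linarith) (by linarith) rfl]
  set ζ := z₁ / z₂
  have hζ1 : ‖ζ‖ < 1 := hζρ.trans_lt hρ1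
  have hne := one_sub_ne_zero_of_norm_lt_one hζ1
  have hNpos : (1 : ℝ) ≤ N := by exact_mod_cast hN
  have hN0 : (N : ℂ) ≠ 0 := by exact_mod_cast (by omega : N ≠ 0)
  have hinv : ‖(1 - ζ)⁻¹‖ ≤ D := by
    rw [norm_inv, hD]
    have h1 : (1 : ℝ) - ‖ζ‖ ≤ ‖1 - ζ‖ := by
      have := norm_sub_norm_le (1 : ℂ) ζ
      rwa [norm_one] at this
    exact inv_anti₀ (by linarith) (by linarith)
  have h9 := norm_oddPowSum_le hζρ hρ1 9
  have h10 := norm_lerchSum_sub_lerchTrunc_le 10 hN hζρ hρ1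
  have hL := norm_lerchSum_le (N := N) hζρ hρ1
  rw [← hK9] at h9
  rw [← hK10] at h10
  rw [← hD] at hL
  have hK9' : 0 ≤ K₉ := (norm_nonneg _).trans h9
  have hK10' : 0 ≤ K₁₀ := tsum_nonneg fun _ => by positivity
  have hexp := expansion_eq hN hζ1
  set u := (1 - ζ)⁻¹ with hu
  have hsplit : -4 * ζ * (1 - ζ ^ N) / (1 - ζ) ^ 2
      + 4 * (2 * ζ ^ 2 * (1 - ζ ^ N) / (1 - ζ) ^ 2
        - ζ * ((N : ℂ) - 1 + (N + 1) * ζ ^ N) / (1 - ζ)) * lerchSum N ζ - coeGlobalExpansion N ζ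
      = -(4 * (ζ * (1 + ζ) * u ^ 2) * oddPowSum 9 ζ / (N : ℂ) ^ 10)
        + 4 * (ζ * (1 + ζ) * u ^ 2 - ζ * N * u) * (lerchSum N ζ - lerchTrunc 10 N ζ)
        + ζ ^ N * (4 * ζ * u ^ 2 + 4 * (-2 * ζ ^ 2 * u ^ 2 - ζ * (N + 1) * u) * lerchSum N ζ) := by
    rw [show coeGlobalExpansion N ζ = _ from (sub_eq_iff_eq_add.1 hexp.symm)]
    rw [hu]
    field_simp
    ring
  rw [hsplit]
  have hone : ‖1 + ζ‖ ≤ 2 := (norm_add_le _ _).trans (by rw [norm_one]; linarith)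
  have hζle : ‖ζ‖ ≤ 1 := hζ1.le
  have hprod : ‖ζ * (1 + ζ) * u ^ 2‖ ≤ 2 * D ^ 2 := by
    rw [norm_mul, norm_mul, norm_pow]
    calc ‖ζ‖ * ‖1 + ζ‖ * ‖u‖ ^ 2 ≤ 1 * 2 * D ^ 2 := by gcongr
      _ = 2 * D ^ 2 := by ring
  have hA : ‖-(4 * (ζ * (1 + ζ) * u ^ 2) * oddPowSum 9 ζ / (N : ℂ) ^ 10)‖
      ≤ 4 * (2 * D ^ 2) * K₉ / (N : ℝ) ^ 10 := by
    rw [norm_neg, norm_div, norm_mul, norm_mul, norm_pow, Complex.norm_natCast, Complex.norm_ofNat]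
    gcongr
  -- The prefactor is of order `N`, which the truncation error of order `N^{-11}` absorbs.
  have hB : ‖4 * (ζ * (1 + ζ) * u ^ 2 - ζ * N * u) * (lerchSum N ζ - lerchTrunc 10 N ζ)‖
      ≤ 4 * (2 * D ^ 2 + D) * K₁₀ / (N : ℝ) ^ 10 := by
    rw [norm_mul, norm_mul, Complex.norm_ofNat]
    have h1 : ‖ζ * (1 + ζ) * u ^ 2 - ζ * N * u‖ ≤ (2 * D ^ 2 + D) * N := by
      refine (norm_sub_le _ _).trans ?_
      have h2 : ‖ζ * N * u‖ ≤ 1 * N * D := by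
        rw [norm_mul, norm_mul, Complex.norm_natCast]
        gcongr
      have h3 : 2 * D ^ 2 * 1 ≤ 2 * D ^ 2 * (N : ℝ) := by gcongr
      linarith
    calc 4 * ‖ζ * (1 + ζ) * u ^ 2 - ζ * N * u‖ * ‖lerchSum N ζ - lerchTrunc 10 N ζ‖
        ≤ 4 * ((2 * D ^ 2 + D) * N) * (K₁₀ / (N : ℝ) ^ (10 + 1)) := by gcongr
      _ = _ := by field_simp; ring
  have hC : ‖ζ ^ N * (4 * ζ * u ^ 2 + 4 * (-2 * ζ ^ 2 * u ^ 2 - ζ * (N + 1) * u) * lerchSum N ζ)‖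
      ≤ M * (4 * D ^ 2 + 4 * (2 * D ^ 2 + 2 * D) * D) / (N : ℝ) ^ 10 := by
    have h1 : ‖4 * ζ * u ^ 2‖ ≤ 4 * D ^ 2 := by
      rw [norm_mul, norm_mul, norm_pow, Complex.norm_ofNat]
      calc 4 * ‖ζ‖ * ‖u‖ ^ 2 ≤ 4 * 1 * D ^ 2 := by gcongr
        _ = _ := by ring
    have h2 : ‖-2 * ζ ^ 2 * u ^ 2‖ ≤ 2 * D ^ 2 := by
      rw [norm_mul, norm_mul, norm_pow, norm_pow, norm_neg, Complex.norm_ofNat]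
      calc 2 * ‖ζ‖ ^ 2 * ‖u‖ ^ 2 ≤ 2 * 1 ^ 2 * D ^ 2 := by gcongr
        _ = _ := by ring
    have h3 : ‖ζ * ((N : ℂ) + 1) * u‖ ≤ (2 * N) * D := by
      rw [norm_mul, norm_mul, show (N : ℂ) + 1 = ((N + 1 : ℕ) : ℂ) by push_cast; ring,
        Complex.norm_natCast]
      have : ((N + 1 : ℕ) : ℝ) ≤ 2 * N := by push_cast; linarith
      calc ‖ζ‖ * ((N + 1 : ℕ) : ℝ) * ‖u‖ ≤ 1 * (2 * N) * D := by gcongr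
        _ = _ := by ring
    have h4 : ‖4 * (-2 * ζ ^ 2 * u ^ 2 - ζ * (N + 1) * u) * lerchSum N ζ‖
        ≤ 4 * (2 * D ^ 2 + (2 * N) * D) * D := by
      rw [norm_mul, norm_mul, Complex.norm_ofNat]
      gcongr
      exact (norm_sub_le _ _).trans (add_le_add h2 h3)
    have h5 : ‖4 * ζ * u ^ 2 + 4 * (-2 * ζ ^ 2 * u ^ 2 - ζ * (N + 1) * u) * lerchSum N ζ‖
        ≤ (4 * D ^ 2 + 4 * (2 * D ^ 2 + 2 * D) * D) * N := by
      refine (norm_add_le _ _).trans ((add_le_add h1 h4).trans ?_)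
      have h6 : (4 * D ^ 2 + 8 * D ^ 3) * 1 ≤ (4 * D ^ 2 + 8 * D ^ 3) * (N : ℝ) := by gcongr
      linarith
    have h7 : ‖ζ‖ ^ N ≤ ρ ^ N := by gcongr
    rw [norm_mul, norm_pow, le_div_iff₀ (by positivity)]
    calc ‖ζ‖ ^ N * ‖4 * ζ * u ^ 2 + 4 * (-2 * ζ ^ 2 * u ^ 2 - ζ * (N + 1) * u) * lerchSum N ζ‖
          * (N : ℝ) ^ 10
        ≤ ρ ^ N * ((4 * D ^ 2 + 4 * (2 * D ^ 2 + 2 * D) * D) * N) * (N : ℝ) ^ 10 := by gcongr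
      _ = ((N : ℝ) ^ 11 * ρ ^ N) * (4 * D ^ 2 + 4 * (2 * D ^ 2 + 2 * D) * D) := by ring
      _ ≤ _ := by gcongr; exact hM N
  refine (norm_add₃_le).trans ?_
  rw [add_div, add_div]
  exact add_le_add (add_le_add hA hB) hC

end CircularEnsemble

theorem proposition5p4 :
    (∀ N : ℕ, 1 ≤ N → ∀ z₁ z₂ : ℂ, ‖z₁‖ < 1 → 1 < ‖z₂‖ →
      CircularEnsemble.coeW₂ N z₁ z₂ = CircularEnsemble.coeExact N (z₁ / z₂)) ∧
    (∀ δ : ℝ, 0 < δ → δ < 1 → ∃ C : ℝ, ∀ N : ℕ, 1 ≤ N →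
      ∀ z₁ z₂ : ℂ, ‖z₁‖ < 1 - δ → 1 + δ < ‖z₂‖ →
        ‖CircularEnsemble.coeW₂ N z₁ z₂ - CircularEnsemble.coeGlobalExpansion N (z₁ / z₂)‖
          ≤ C / (N : ℝ) ^ 10) :=
  ⟨fun _ hN _ _ hz₁ hz₂ => CircularEnsemble.coeW₂_eq_coeExact hN hz₁ hz₂,
    fun _ hδ hδ1 => CircularEnsemble.exists_bound_coeW₂_sub hδ hδ1⟩
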